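/- Let $\mathbf{k}$ be an arbitrary field. An endomorphism of $\mathbb{A}^n=\mathbb{A}^n_{\mathbf k}$ is a tuple $f=(f_1,\dots,f_n)$ of polynomials in $\mathbf{k}[x_1,\dots,x_n]$; endomorphisms form a monoid under composition, and $\mathrm{Aut}(\mathbb{A}^n)$ is its group of invertible elements. Put $\deg f=\max_i\deg f_i$, and let $\lambda(f)=\lim_{r\to\infty}\deg(f^r)^{1/r}$ be the dynamical degree. Call $f$ triangular if $f_i\in\mathbf{k}[x_1,\dots,x_i]$ for each $i$; affine-triangular if $f=\alpha\circ\tau$ with $\tau$ a triangular endomorphism and $\alpha$ an automorphism of degree $1$; permutation-triangular if $f=\alpha\circ\tau$ with $\tau$ a triangular endomorphism and $\alpha$ a permutation of the coordinates. For $\mu\in(\mathbb{R}_{\ge0})^n\setminus\{0\}$ and a polynomial $p\ne0$, let $\deg_\mu(p)$ be the maximum of $\sum_i a_i\mu_i$ over the monomials $x_1^{a_1}\cdots x_n^{a_n}$ with nonzero coefficient in $p$, and $\deg_\mu(0)=-\infty$. Let $\deg_\mu(f)=\inf\{\theta\ge0 : \deg_\mu(f_i)\le\theta\mu_i\ \text{for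 all } i\}\in[0,\infty]$ (with $\inf\emptyset=\infty$). Say that $f$ is $\mu$-algebraically stable if $\deg_\mu(f)<\infty$ and $\deg_\mu(f^r)=\deg_\mu(f)^r$ for all $r\ge1$. A matrix $M=(m_{ij})\in\mathrm{Mat}_n(\mathbb{N})$ is contained in $f$ if for each $i$ the monomial $\prod_j x_j^{m_{ij}}$ has nonzero coefficient in $f_i$. For $f$ with all $f_i\neq 0$, the maximal eigenvalue of $f$ is the maximum $\theta$ of $|\xi|$ over all complex eigenvalues $\xi$ of matrices contained in $f$; a maximal eigenvector of $f$ is a $\mu\in(\mathbb{R}_{\ge0})^n\setminus\{0\}$ with $\deg_\mu(f_i)=\theta\mu_i$ for all $i$. A Handelman number is a positive real root of a monic integral polynomial all of whose non-leading coefficients are non-positive. **Proposition D.** Every affine-triangular automorphism $f\in\mathrm{Aut}(\mathbb{A}^3)$ is conjugate in $\mathrm{Aut}(\mathbb{A}^3)$ to a permutation-triangular automorphism $f'\in\mathrm{Aut}(\mathbb{A}^3)$ such that $\deg(f')\le\deg(f)$ and such that either the maximal eigenvalue $\theta$ of $f'$ is equal to $1$, or $f'$ is $\mu$-algebraically stable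 for each maximal eigenvector $\mu$ of $f'$. Moreover, the dynamical degrees $\lambda(f)$ and $\lambda(f')$ are both equal to the maximal eigenvalue $\theta$ of $f'$, which is a Handelman number. -/

import Mathlib

open scoped NNReal ENNReal Topology

noncomputable section

/-- Endomorphisms `f = (f₁, …, fₙ)` of the affine space `𝔸ⁿ` over `k`: `n`-tuples of polynomials
in `k[x₁, …, xₙ]` (indexed by `Fin n`). -/
def AffEnd (k : Type*) [CommSemiring k] (n : ℕ) : Type _ :=
  Fin n → MvPolynomial (Fin n) k

namespace AffEnd

variable {k : Type*} [Field k] {n : ℕ}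

/-- The composition `f ∘ g = (f₁(g₁, …, gₙ), …, fₙ(g₁, …, gₙ))`. -/
def comp (f g : AffEnd k n) : AffEnd k n :=
  fun i => MvPolynomial.bind₁ g (f i)

/-- The monoid `End(𝔸ⁿ)`: multiplication is composition, the unit is `(x₁, …, xₙ)`.
Its units are the automorphisms of `𝔸ⁿ`, and `f ^ r` is the `r`-th iterate of `f`. -/
instance : Monoid (AffEnd k n) where
  mul := comp
  one := fun i => MvPolynomial.X i
  mul_assoc f g h := by
    funext i
    exact MvPolynomial.bind₁_bind₁ g h (f i)
  one_mul f := by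
    funext i
    exact MvPolynomial.bind₁_X_right f i
  mul_one f := by
    funext i
    exact congrArg (fun φ => φ (f i)) (MvPolynomial.bind₁_X_left (σ := Fin n) (R := k))

/-- `deg(f) = max(deg(f₁), …, deg(fₙ))`. -/
def degree (f : AffEnd k n) : ℕ :=
  Finset.univ.sup fun i => (f i).totalDegree

/-- `f` is an automorphism of `𝔸ⁿ`. -/
def IsAut (f : AffEnd k n) : Prop := IsUnit f

/-- `f` is triangular: `fᵢ ∈ k[x₁, …, xᵢ]` for each `i`. -/
def IsTriangular (f : AffEnd k n) : Prop :=
  ∀ i, f i ∈ MvPolynomial.supported k (Set.Iic i)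

/-- `f` is an affine automorphism. -/
def IsAffineAut (f : AffEnd k n) : Prop :=
  f.IsAut ∧ f.degree = 1

/-- `f` is a permutation of the coordinates. -/
def IsCoordPerm (f : AffEnd k n) : Prop :=
  ∃ σ : Equiv.Perm (Fin n), ∀ i, f i = MvPolynomial.X (σ i)

/-- `f = α ∘ τ` with `α` an affine automorphism and `τ` a triangular endomorphism. -/
def IsAffineTriangular (f : AffEnd k n) : Prop :=
  ∃ α τ : AffEnd k n, α.IsAffineAut ∧ τ.IsTriangular ∧ f = α * τ

/-- `f = α ∘ τ` with `α` a permutation of the coordinates and `τ` a triangular endomorphism. -/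
def IsPermTriangular (f : AffEnd k n) : Prop :=
  ∃ α τ : AffEnd k n, α.IsCoordPerm ∧ τ.IsTriangular ∧ f = α * τ

/-- `lam` is the dynamical degree of `f`: `deg(f ^ r) ^ (1 / r)` tends to `lam` as `r → ∞`. -/
def HasDynamicalDegree (f : AffEnd k n) (lam : ℝ) : Prop :=
  Filter.Tendsto (fun r : ℕ => ((f ^ r).degree : ℝ) ^ (1 / (r : ℝ))) Filter.atTop (𝓝 lam)

/-- The `μ`-degree of an endomorphism: the infimum of all `θ ≥ 0` with `deg_μ(fᵢ) ≤ θ μᵢ` for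
each `i`, which is `∞` if there is no such `θ`. The `μ`-degree of a polynomial, with value `-∞`
at `0`, is `MvPolynomial.weightedTotalDegree'`. -/
def muDegree (μ : Fin n → ℝ≥0) (f : AffEnd k n) : ℝ≥0∞ :=
  ⨅ (θ : ℝ≥0) (_ : ∀ i, MvPolynomial.weightedTotalDegree' μ (f i)
    ≤ ((θ * μ i : ℝ≥0) : WithBot ℝ≥0)), (θ : ℝ≥0∞)

/-- `f` is `μ`-algebraically stable. -/
def IsMuAlgStable (μ : Fin n → ℝ≥0) (f : AffEnd k n) : Prop :=
  f.muDegree μ < ⊤ ∧ ∀ r : ℕ, 1 ≤ r → (f ^ r).muDegree μ = f.muDegree μ ^ r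

/-- The matrix `M` is contained in `f`: for each `i`, the coefficient of the monomial
`∏ⱼ xⱼ ^ (M i j)` in `fᵢ` is nonzero. -/
def ContainsMatrix (f : AffEnd k n) (M : Matrix (Fin n) (Fin n) ℕ) : Prop :=
  ∀ i, MvPolynomial.coeff (Finsupp.equivFunOnFinite.symm (M i)) (f i) ≠ 0

/-- `θ` is the maximal eigenvalue of `f`: the maximum of `|ξ|`, where `ξ` runs over the complex
eigenvalues of the matrices contained in `f`. -/
def IsMaximalEigenvalue (f : AffEnd k n) (θ : ℝ≥0) : Prop :=
  IsGreatest {t : ℝ≥0 | ∃ M : Matrix (Fin n) (Fin n) ℕ, f.ContainsMatrix M ∧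
    ∃ ξ : ℂ, Module.End.HasEigenvalue
      (Matrix.toLin' (M.map (fun m : ℕ => (m : ℂ)))) ξ ∧ t = ‖ξ‖₊} θ

/-- `μ` is a maximal eigenvector of `f`: `μ ≠ 0` has non-negative entries and
`deg_μ(fᵢ) = θ μᵢ` for each `i`, where `θ` is the maximal eigenvalue of `f`. -/
def IsMaximalEigenvector (f : AffEnd k n) (μ : Fin n → ℝ≥0) : Prop :=
  μ ≠ 0 ∧ ∃ θ : ℝ≥0, f.IsMaximalEigenvalue θ ∧
    ∀ i, MvPolynomial.weightedTotalDegree' μ (f i) = ((θ * μ i : ℝ≥0) : WithBot ℝ≥0)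

end AffEnd

/-- A Handelman number: a positive real number that is a root of a monic integral polynomial all
of whose coefficients, except the leading one, are non-positive. -/
def IsHandelman (x : ℝ) : Prop :=
  0 < x ∧ ∃ P : Polynomial ℤ, P.Monic ∧ (∀ i < P.natDegree, P.coeff i ≤ 0) ∧
    Polynomial.aeval x P = 0

end

/-!
By a Bruhat-type factorization of the linear part of `α`, the map `f = α ∘ τ` is conjugate to a
permutation of the components `a x₀ + b`, `c x₁ + p(x₀)`, `e x₂ + q(x₀, x₁)` of a triangular
automorphism. For each of the six permutations one finds a solution of `deg_μ(fᵢ) = θ μᵢ` with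
`θ ≥ 1`; perturbing `μ` to a positive weight shows that `θ` bounds the eigenvalues of all contained
matrices and the growth of degrees. As `θ² = i θ + j` for some `i, j ∈ ℕ`, it is a Handelman number.

If `θ > 1`, then `f` is `μ`-algebraically stable as soon as some coordinate of positive weight
survives under all iterates of the `μ`-leading part of `f`. For the cycle with first component
`e x₂ + q` one reaches this after a conjugation that makes `p` vanish. The only other obstruction is
in the cycle with first component `c x₁ + p`, when the leading part of `e x₂ + q` is a constant
multiple of the `d`-th power of the leading part of `c x₁ + p`, with `d = deg p`. Conjugating by the
shear `x₁ ↦ c x₁ + γ x₀ ^ d`, where `γ x₀ ^ d` is the leading term of `p`, then lowers the degree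
of `p`, so that the process ends.
-/

noncomputable section

open MvPolynomial

/-! ### Weights and leading forms -/

section Weights

open scoped Pointwise

variable {R σ τ ι : Type*} {μ : σ → ℝ≥0} {ν : τ → ℝ≥0} {θ v w : ℝ≥0}

section CommSemiring

variable [CommSemiring R] {P Q : MvPolynomial σ R}

variable (R) in
/-- The polynomials of `μ`-degree at most `w`, together with `0`. -/
def weightLE (μ : σ → ℝ≥0) (w : ℝ≥0) : Submodule R (MvPolynomial σ R) :=
  restrictSupport R {m | Finsupp.weight μ m ≤ w}

variable (R) in
/-- The polynomials of `μ`-degree less than `w`, together with `0`. -/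
def weightLT (μ : σ → ℝ≥0) (w : ℝ≥0) : Submodule R (MvPolynomial σ R) :=
  restrictSupport R {m | Finsupp.weight μ m < w}

theorem mem_weightLE : P ∈ weightLE R μ w ↔ ∀ m ∈ P.support, Finsupp.weight μ m ≤ w :=
  Iff.rfl

theorem mem_weightLT : P ∈ weightLT R μ w ↔ ∀ m ∈ P.support, Finsupp.weight μ m < w :=
  Iff.rfl

theorem mem_weightLE_iff_weightedTotalDegree_le :
    P ∈ weightLE R μ w ↔ weightedTotalDegree μ P ≤ w :=
  mem_weightLE.trans Finset.sup_le_iff.symm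

theorem weightLT_le_weightLE : weightLT R μ w ≤ weightLE R μ w :=
  fun _ hP => mem_weightLE.2 fun m hm => (mem_weightLT.1 hP m hm).le

theorem weightLE_mono (h : v ≤ w) : weightLE R μ v ≤ weightLE R μ w :=
  fun _ hP => mem_weightLE.2 fun m hm => (mem_weightLE.1 hP m hm).trans h

theorem mul_mem_restrictSupport {s t u : Set (σ →₀ ℕ)} (h : s + t ⊆ u)
    (hP : P ∈ restrictSupport R s) (hQ : Q ∈ restrictSupport R t) :
    P * Q ∈ restrictSupport R u :=
  restrictSupport_mono R h (restrictSupport_add R s t ▸ Submodule.mul_mem_mul hP hQ)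

theorem mul_mem_weightLE (hP : P ∈ weightLE R μ v) (hQ : Q ∈ weightLE R μ w) :
    P * Q ∈ weightLE R μ (v + w) := by
  refine mul_mem_restrictSupport ?_ hP hQ
  rintro _ ⟨m, hm, m', hm', rfl⟩
  exact (map_add (Finsupp.weight μ) m m').trans_le (add_le_add hm hm')

theorem mul_mem_weightLT (hP : P ∈ weightLT R μ v) (hQ : Q ∈ weightLE R μ w) :
    P * Q ∈ weightLT R μ (v + w) := by
  refine mul_mem_restrictSupport ?_ hP hQ
  rintro _ ⟨m, hm, m', hm', rfl⟩
  exact (map_add (Finsupp.weight μ) m m').trans_lt (add_lt_add_of_lt_of_le hm hm')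

theorem C_mem_weightLE (c : R) : C c ∈ weightLE R μ w :=
  (monomial_mem_restrictSupport R).2 (Or.inl (by simp))

theorem X_mem_weightLE (i : σ) : X i ∈ weightLE R μ (μ i) :=
  (monomial_mem_restrictSupport R).2 (Or.inl (by simp [Finsupp.weight_single]))

theorem C_mul_mem {M : Submodule R (MvPolynomial σ R)} (c : R) (hP : P ∈ M) : C c * P ∈ M :=
  C_mul' (a := c) (p := P) ▸ M.smul_mem c hP

theorem pow_mem_weightLE (hP : P ∈ weightLE R μ w) (r : ℕ) : P ^ r ∈ weightLE R μ (r • w) := by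
  induction r with
  | zero => exact C_mem_weightLE (1 : R)
  | succ r ih =>
    rw [pow_succ, succ_nsmul]
    exact mul_mem_weightLE ih hP

theorem prod_pow_mem_weightLE {w : ι → ℝ≥0} {P : ι → MvPolynomial σ R}
    (h : ∀ i, P i ∈ weightLE R μ (w i)) (s : Finset ι) (m : ι → ℕ) :
    ∏ i ∈ s, P i ^ m i ∈ weightLE R μ (∑ i ∈ s, m i • w i) := by
  induction s using Finset.cons_induction with
  | empty => exact C_mem_weightLE (1 : R)
  | cons i s hi ih =>
    rw [Finset.sum_cons, Finset.prod_cons]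
    exact mul_mem_weightLE (pow_mem_weightLE (h i) _) ih

theorem bind₁_eq_sum (f : σ → MvPolynomial τ R) (P : MvPolynomial σ R) :
    bind₁ f P = ∑ m ∈ P.support, C (coeff m P) * ∏ i ∈ m.support, f i ^ m i :=
  eval₂_eq _ _ _

theorem sum_support_smul_mul (μ : σ → ℝ≥0) (θ : ℝ≥0) (m : σ →₀ ℕ) :
    ∑ i ∈ m.support, m i • (θ * μ i) = θ * Finsupp.weight μ m := by
  simp only [Finsupp.weight_apply, Finsupp.sum, Finset.mul_sum, mul_smul_comm]

theorem prod_pow_support_mem_weightLE {f : σ → MvPolynomial τ R}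
    (hf : ∀ i, f i ∈ weightLE R ν (θ * μ i)) (m : σ →₀ ℕ) :
    ∏ i ∈ m.support, f i ^ m i ∈ weightLE R ν (θ * Finsupp.weight μ m) :=
  sum_support_smul_mul μ θ m ▸ prod_pow_mem_weightLE hf m.support m

theorem bind₁_mem_weightLE {f : σ → MvPolynomial τ R} (hf : ∀ i, f i ∈ weightLE R ν (θ * μ i))
    (hP : P ∈ weightLE R μ w) : bind₁ f P ∈ weightLE R ν (θ * w) := by
  rw [bind₁_eq_sum]
  exact sum_mem fun m hm => C_mul_mem _ <|
    weightLE_mono (mul_le_mul_right (mem_weightLE.1 hP m hm) θ) (prod_pow_support_mem_weightLE hf m)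

theorem bind₁_mem_weightLT (hθ : 0 < θ) {f : σ → MvPolynomial τ R}
    (hf : ∀ i, f i ∈ weightLE R ν (θ * μ i)) (hP : P ∈ weightLT R μ w) :
    bind₁ f P ∈ weightLT R ν (θ * w) := by
  rw [bind₁_eq_sum]
  exact sum_mem fun m hm => C_mul_mem _ <| mem_weightLT.2 fun _ hm' =>
    (mem_weightLE.1 (prod_pow_support_mem_weightLE hf m) _ hm').trans_lt
      (mul_lt_mul_of_pos_left (mem_weightLT.1 hP m hm) hθ)

theorem mem_weightLE_of_isWeightedHomogeneous (h : IsWeightedHomogeneous μ P w) :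
    P ∈ weightLE R μ w :=
  mem_weightLE.2 fun _ hm => (h (mem_support_iff.1 hm)).le

theorem mem_weightLE_one_iff {d : ℕ} :
    P ∈ weightLE R (1 : σ → ℝ≥0) d ↔ P.totalDegree ≤ d := by
  have weight_one (m : σ →₀ ℕ) :
      Finsupp.weight (1 : σ → ℝ≥0) m = (m.sum fun _ e => e : ℕ) := by
    simp [Finsupp.weight_apply, Finsupp.sum]
  simp only [mem_weightLE, weight_one, Nat.cast_le]
  exact Finset.sup_le_iff.symm

end CommSemiring

section CommRing

variable [CommRing R] {P P₀ Q Q₀ : MvPolynomial σ R}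

/-- `P₀` is the component of `P` of `μ`-weight `w`, and all other monomials of `P` have smaller
weight. The form `P₀` may vanish. -/
def IsLeadingForm (μ : σ → ℝ≥0) (w : ℝ≥0) (P P₀ : MvPolynomial σ R) : Prop :=
  IsWeightedHomogeneous μ P₀ w ∧ P - P₀ ∈ weightLT R μ w

theorem isLeadingForm_C (c : R) : IsLeadingForm μ 0 (C c : MvPolynomial σ R) (C c) :=
  ⟨isWeightedHomogeneous_C μ c, by simp only [sub_self, zero_mem]⟩

theorem isLeadingForm_weightedHomogeneousComponent (h : P ∈ weightLE R μ w) :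
    IsLeadingForm μ w P (weightedHomogeneousComponent μ w P) := by
  classical
  refine ⟨weightedHomogeneousComponent_isWeightedHomogeneous w P,
    mem_weightLT.2 fun m hm => ?_⟩
  rw [mem_support_iff, coeff_sub, coeff_weightedHomogeneousComponent] at hm
  split_ifs at hm with hw
  · exact absurd (sub_self _) hm
  · rw [sub_zero] at hm
    exact lt_of_le_of_ne (mem_weightLE.1 h m (mem_support_iff.2 hm)) hw

namespace IsLeadingForm

theorem mem_weightLE (h : IsLeadingForm μ w P P₀) : P ∈ weightLE R μ w :=
  sub_add_cancel P P₀ ▸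
    add_mem (weightLT_le_weightLE h.2) (mem_weightLE_of_isWeightedHomogeneous h.1)

theorem mul (hP : IsLeadingForm μ v P P₀) (hQ : IsLeadingForm μ w Q Q₀) :
    IsLeadingForm μ (v + w) (P * Q) (P₀ * Q₀) := by
  refine ⟨hP.1.mul hQ.1, ?_⟩
  have hlow : P₀ * (Q - Q₀) ∈ weightLT R μ (v + w) := by
    rw [mul_comm, add_comm]
    exact mul_mem_weightLT hQ.2 (mem_weightLE_of_isWeightedHomogeneous hP.1)
  rw [show P * Q - P₀ * Q₀ = (P - P₀) * Q + P₀ * (Q - Q₀) by ring]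
  exact add_mem (mul_mem_weightLT hP.2 hQ.mem_weightLE) hlow

theorem pow (hP : IsLeadingForm μ w P P₀) (r : ℕ) : IsLeadingForm μ (r • w) (P ^ r) (P₀ ^ r) := by
  induction r with
  | zero => simpa only [pow_zero, zero_smul, C_1] using isLeadingForm_C (μ := μ) (1 : R)
  | succ r ih =>
    rw [pow_succ, pow_succ, succ_nsmul]
    exact ih.mul hP

theorem prod_pow {w : ι → ℝ≥0} {P P₀ : ι → MvPolynomial σ R}
    (h : ∀ i, IsLeadingForm μ (w i) (P i) (P₀ i)) (s : Finset ι) (m : ι → ℕ) :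
    IsLeadingForm μ (∑ i ∈ s, m i • w i) (∏ i ∈ s, P i ^ m i) (∏ i ∈ s, P₀ i ^ m i) := by
  induction s using Finset.cons_induction with
  | empty => exact isLeadingForm_C (1 : R)
  | cons i s hi ih =>
    rw [Finset.sum_cons, Finset.prod_cons, Finset.prod_cons]
    exact ((h i).pow _).mul ih

theorem sum {s : Finset ι} {P P₀ : ι → MvPolynomial σ R}
    (h : ∀ i ∈ s, IsLeadingForm μ w (P i) (P₀ i)) :
    IsLeadingForm μ w (∑ i ∈ s, P i) (∑ i ∈ s, P₀ i) := by
  refine ⟨IsWeightedHomogeneous.sum s _ _ fun i hi => (h i hi).1, ?_⟩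
  rw [← Finset.sum_sub_distrib]
  exact sum_mem fun i hi => (h i hi).2

theorem coeff_eq (h : IsLeadingForm μ w P P₀) {m : σ →₀ ℕ} (hm : Finsupp.weight μ m = w) :
    coeff m P = coeff m P₀ := by
  by_contra hne
  exact (mem_weightLT.1 h.2 m (mem_support_iff.2 (by rwa [coeff_sub, sub_ne_zero]))).ne hm

theorem bind₁_of_isWeightedHomogeneous {f g : σ → MvPolynomial τ R}
    (hf : ∀ i, IsLeadingForm ν (θ * μ i) (f i) (g i)) (hP : IsWeightedHomogeneous μ P w) :
    IsLeadingForm ν (θ * w) (bind₁ f P) (bind₁ g P) := by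
  rw [bind₁_eq_sum, bind₁_eq_sum]
  refine IsLeadingForm.sum fun m hm => ?_
  have h := (isLeadingForm_C (coeff m P)).mul (prod_pow hf m.support m)
  rwa [sum_support_smul_mul, hP (mem_support_iff.1 hm), zero_add] at h

theorem bind₁ (hθ : 0 < θ) {f g : σ → MvPolynomial τ R}
    (hf : ∀ i, IsLeadingForm ν (θ * μ i) (f i) (g i)) (hP : IsLeadingForm μ w P P₀) :
    IsLeadingForm ν (θ * w) (bind₁ f P) (bind₁ g P₀) := by
  have hlead := bind₁_of_isWeightedHomogeneous hf hP.1
  have hlow := bind₁_mem_weightLT hθ (fun i => (hf i).mem_weightLE) hP.2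
  refine ⟨hlead.1, ?_⟩
  rw [map_sub] at hlow
  simpa only [sub_add_sub_cancel] using add_mem hlow hlead.2

end IsLeadingForm

end CommRing

end Weights

section WeightedTotalDegree

variable {R σ : Type*} [CommSemiring R] {μ : σ → ℝ≥0} {w : ℝ≥0} {P : MvPolynomial σ R}

theorem weightedTotalDegree'_le_iff :
    weightedTotalDegree' μ P ≤ (w : WithBot ℝ≥0) ↔ P ∈ weightLE R μ w := by
  simp only [weightedTotalDegree', mem_weightLE, Finset.sup_le_iff, WithBot.coe_le_coe]

theorem weightedTotalDegree'_eq_iff :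
    weightedTotalDegree' μ P = (w : WithBot ℝ≥0) ↔
      P ∈ weightLE R μ w ∧ ∃ m ∈ P.support, Finsupp.weight μ m = w := by
  constructor
  · intro h
    have hP : P.support.Nonempty := by
      rw [Finset.nonempty_iff_ne_empty, Ne, support_eq_empty]
      rintro rfl
      exact WithBot.bot_ne_coe ((weightedTotalDegree'_zero μ).symm.trans h)
    obtain ⟨m, hm, hw⟩ := Finset.exists_mem_eq_sup P.support hP
      fun s => (Finsupp.weight μ s : WithBot ℝ≥0)
    exact ⟨weightedTotalDegree'_le_iff.1 h.le, m, hm, WithBot.coe_injective (hw.symm.trans h)⟩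
  · rintro ⟨h, m, hm, rfl⟩
    exact (weightedTotalDegree'_le_iff.2 h).antisymm
      (Finset.le_sup (f := fun s => (Finsupp.weight μ s : WithBot ℝ≥0)) hm)

theorem IsLeadingForm.exists_mem_support {R : Type*} [CommRing R] {P P₀ : MvPolynomial σ R}
    (h : IsLeadingForm μ w P P₀) (h0 : P₀ ≠ 0) : ∃ m ∈ P.support, Finsupp.weight μ m = w := by
  obtain ⟨m, hm⟩ := ne_zero_iff.1 h0
  exact ⟨m, mem_support_iff.2 (h.coeff_eq (h.1 hm) ▸ hm), h.1 hm⟩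

end WeightedTotalDegree

namespace AffEnd

variable {k : Type*} [Field k] {n : ℕ}

/-- The substitution `P ↦ P(f₁, …, fₙ)`. -/
def subst (f : AffEnd k n) : MvPolynomial (Fin n) k →ₐ[k] MvPolynomial (Fin n) k :=
  MvPolynomial.bind₁ f

/-- The endomorphism with the given components. It gives vectors such as `![P, Q, R]` the type
on which the composition product is defined. -/
def ofFun (v : Fin n → MvPolynomial (Fin n) k) : AffEnd k n := v

@[simp] theorem ofFun_apply (v : Fin n → MvPolynomial (Fin n) k) (i : Fin n) :
    ofFun v i = v i := rfl

@[simp] theorem subst_X (f : AffEnd k n) (i : Fin n) : f.subst (X i) = f i :=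
  bind₁_X_right (σ := Fin n) f i

@[simp] theorem subst_C (f : AffEnd k n) (c : k) : f.subst (C c) = C c :=
  bind₁_C_right (σ := Fin n) f c

theorem mul_apply (f g : AffEnd k n) (i : Fin n) : (f * g) i = g.subst (f i) := rfl

theorem one_apply (i : Fin n) : (1 : AffEnd k n) i = X i := rfl

theorem subst_mul (f g : AffEnd k n) (P : MvPolynomial (Fin n) k) :
    (f * g).subst P = g.subst (f.subst P) :=
  (bind₁_bind₁ f g P).symm

theorem subst_one (P : MvPolynomial (Fin n) k) : (1 : AffEnd k n).subst P = P :=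
  DFunLike.congr_fun (bind₁_X_left (σ := Fin n) (R := k)) P

theorem pow_succ_apply (f : AffEnd k n) (r : ℕ) (i : Fin n) :
    (f ^ (r + 1)) i = f.subst ((f ^ r) i) := by
  rw [pow_succ, mul_apply]

section MuDegree

variable {μ : Fin n → ℝ≥0} {θ : ℝ≥0} {f g : AffEnd k n}

theorem pow_apply_mem_weightLE (hf : ∀ i, f i ∈ weightLE k μ (θ * μ i)) (r : ℕ) (i : Fin n) :
    (f ^ r) i ∈ weightLE k μ (θ ^ r * μ i) := by
  induction r with
  | zero => simpa only [pow_zero, one_mul, one_apply] using X_mem_weightLE i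
  | succ r ih =>
    rw [pow_succ_apply, pow_succ', mul_assoc]
    exact bind₁_mem_weightLE hf ih

theorem isLeadingForm_pow (hθ : 0 < θ) (hf : ∀ i, IsLeadingForm μ (θ * μ i) (f i) (g i))
    (r : ℕ) (i : Fin n) : IsLeadingForm μ (θ ^ r * μ i) ((f ^ r) i) ((g ^ r) i) := by
  induction r with
  | zero =>
    simp only [pow_zero, one_mul, one_apply]
    exact ⟨isWeightedHomogeneous_X k μ i, by simp only [sub_self, zero_mem]⟩
  | succ r ih =>
    rw [pow_succ_apply, pow_succ_apply, pow_succ', mul_assoc]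
    exact ih.bind₁ hθ hf

/-- `μ` is an eigenvector of `f` with eigenvalue `θ`: `deg_μ(fᵢ) = θ μᵢ` for each `i`. -/
def IsEigenvector (f : AffEnd k n) (θ : ℝ≥0) (μ : Fin n → ℝ≥0) : Prop :=
  ∀ i, weightedTotalDegree' μ (f i) = ((θ * μ i : ℝ≥0) : WithBot ℝ≥0)

theorem isEigenvector_iff : f.IsEigenvector θ μ ↔
    ∀ i, f i ∈ weightLE k μ (θ * μ i) ∧ ∃ m ∈ (f i).support, Finsupp.weight μ m = θ * μ i :=
  forall_congr' fun _ => weightedTotalDegree'_eq_iff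

theorem IsEigenvector.mem_weightLE (h : f.IsEigenvector θ μ) (i : Fin n) :
    f i ∈ weightLE k μ (θ * μ i) :=
  (isEigenvector_iff.1 h i).1

theorem muDegree_eq (hf : ∀ i, f i ∈ weightLE k μ (θ * μ i)) {i : Fin n} (hi : 0 < μ i)
    (hm : ∃ m ∈ (f i).support, Finsupp.weight μ m = θ * μ i) : f.muDegree μ = θ := by
  refine le_antisymm (iInf₂_le θ fun j => weightedTotalDegree'_le_iff.2 (hf j)) ?_
  refine le_iInf₂ fun t ht => ?_
  obtain ⟨m, hm, hw⟩ := hm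
  have hle : θ * μ i ≤ t * μ i :=
    hw ▸ _root_.mem_weightLE.1 (weightedTotalDegree'_le_iff.1 (ht i)) m hm
  exact ENNReal.coe_le_coe.2 (le_of_mul_le_mul_right hle hi)

theorem isMuAlgStable_of_isLeadingForm (hθ : 0 < θ)
    (hf : ∀ i, IsLeadingForm μ (θ * μ i) (f i) (g i)) {i : Fin n} (hi : 0 < μ i)
    (hg : ∀ r, (g ^ r) i ≠ 0) : f.IsMuAlgStable μ := by
  have muDegree_pow (r : ℕ) : (f ^ r).muDegree μ = (θ ^ r : ℝ≥0) :=
    muDegree_eq (fun j => (isLeadingForm_pow hθ hf r j).mem_weightLE) hi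
      ((isLeadingForm_pow hθ hf r i).exists_mem_support (hg r))
  have muDegree_self : f.muDegree μ = θ := by simpa only [pow_one] using muDegree_pow 1
  refine ⟨muDegree_self ▸ ENNReal.coe_lt_top, fun r _ => ?_⟩
  rw [muDegree_pow, muDegree_self, ENNReal.coe_pow]

end MuDegree

end AffEnd

section CollatzWielandt

variable {n : Type*} [Fintype n] [DecidableEq n]

theorem nnnorm_le_of_hasEigenvalue {A : Matrix n n ℂ} {μ : n → ℝ≥0} (hμ : ∀ i, 0 < μ i) {t : ℝ≥0}
    (hA : ∀ i, ∑ j, ‖A i j‖₊ * μ j ≤ t * μ i) {ξ : ℂ}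
    (hξ : Module.End.HasEigenvalue (Matrix.toLin' A) ξ) : ‖ξ‖₊ ≤ t := by
  obtain ⟨v, hv⟩ := hξ.exists_hasEigenvector
  obtain ⟨i₀, hi₀⟩ := Function.ne_iff.1 hv.2
  obtain ⟨i, -, hi⟩ := Finset.exists_max_image Finset.univ (fun i => ‖v i‖₊ / μ i)
    ⟨i₀, Finset.mem_univ _⟩
  set c := ‖v i‖₊ / μ i
  have hvi : ‖v i‖₊ = c * μ i := (div_mul_cancel₀ _ (hμ i).ne').symm
  have hvj (j : n) : ‖v j‖₊ ≤ c * μ j := (div_le_iff₀ (hμ j)).1 (hi j (Finset.mem_univ _))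
  have hc : 0 < c := (div_pos (nnnorm_pos.2 hi₀) (hμ i₀)).trans_le (hi i₀ (Finset.mem_univ _))
  have heq : ∑ j, A i j * v j = ξ * v i := congrFun hv.apply_eq_smul i
  refine le_of_mul_le_mul_right ?_ (mul_pos hc (hμ i))
  calc ‖ξ‖₊ * (c * μ i) = ‖∑ j, A i j * v j‖₊ := by rw [heq, nnnorm_mul, hvi]
    _ ≤ ∑ j, ‖A i j‖₊ * ‖v j‖₊ := (nnnorm_sum_le _ _).trans_eq (by simp only [nnnorm_mul])
    _ ≤ ∑ j, ‖A i j‖₊ * (c * μ j) := by gcongr with j; exact hvj j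
    _ = c * ∑ j, ‖A i j‖₊ * μ j := by simp only [Finset.mul_sum, mul_left_comm]
    _ ≤ c * (t * μ i) := by gcongr; exact hA i
    _ = t * (c * μ i) := mul_left_comm _ _ _

end CollatzWielandt

namespace AffEnd

variable {k : Type*} [Field k] {n : ℕ} {f : AffEnd k n} {θ : ℝ≥0}

theorem IsEigenvector.exists_containsMatrix {μ : Fin n → ℝ≥0} (h : f.IsEigenvector θ μ) :
    ∃ M : Matrix (Fin n) (Fin n) ℕ, f.ContainsMatrix M ∧ ∀ i, ∑ j, M i j * μ j = θ * μ i := by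
  choose m hm hw using fun i => (isEigenvector_iff.1 h i).2
  refine ⟨Matrix.of fun i j => m i j, fun i => ?_, fun i => ?_⟩
  · rw [show Finsupp.equivFunOnFinite.symm (Matrix.of (fun i j => m i j) i) = m i from
      Finsupp.ext fun _ => rfl]
    exact mem_support_iff.1 (hm i)
  · simpa only [Matrix.of_apply, Finsupp.weight_eq_sum, nsmul_eq_mul] using hw i

theorem ContainsMatrix.sum_mul_le {M : Matrix (Fin n) (Fin n) ℕ} (hM : f.ContainsMatrix M)
    {μ : Fin n → ℝ≥0} {i : Fin n} {w : ℝ≥0} (h : f i ∈ weightLE k μ w) :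
    ∑ j, M i j * μ j ≤ w := by
  simpa only [Finsupp.weight_eq_sum, Finsupp.equivFunOnFinite_symm_apply_apply, nsmul_eq_mul]
    using mem_weightLE.1 h _ (mem_support_iff.2 (hM i))

theorem isMaximalEigenvalue_of_isEigenvector
    (hub : ∀ δ : ℝ≥0, 0 < δ → ∃ μ : Fin n → ℝ≥0, (∀ i, 0 < μ i) ∧
      ∀ i, f i ∈ weightLE k μ ((θ + δ) * μ i))
    {ν : Fin n → ℝ≥0} (hν : ν ≠ 0) (hE : f.IsEigenvector θ ν) : f.IsMaximalEigenvalue θ := by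
  constructor
  · obtain ⟨M, hM, hMν⟩ := hE.exists_containsMatrix
    refine ⟨M, hM, θ, ?_, by simp⟩
    refine Module.End.hasEigenvalue_of_hasEigenvector (x := fun i => ((ν i : ℝ≥0) : ℂ))
      ⟨Module.End.mem_eigenspace_iff.2 (funext fun i => ?_), fun h0 => hν (funext fun i => ?_)⟩
    · simpa [Matrix.mulVec, dotProduct] using congrArg (fun t : ℝ≥0 => ((t : ℝ) : ℂ)) (hMν i)
    · simpa using congrFun h0 i
  · rintro t ⟨M, hM, ξ, hξ, rfl⟩
    refine le_of_forall_pos_le_add fun δ hδ => ?_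
    obtain ⟨μ, hμ, h⟩ := hub δ hδ
    refine nnnorm_le_of_hasEigenvalue hμ (fun i => ?_) hξ
    simpa using hM.sum_mul_le (h i)

end AffEnd

/-! ### Growth of degrees -/

theorem tendsto_const_mul_pow_rpow_inv {c : ℝ≥0} (hc : 0 < c) (t : ℝ≥0) :
    Filter.Tendsto (fun r : ℕ => ((c * t ^ r : ℝ≥0) : ℝ) ^ (1 / (r : ℝ))) Filter.atTop (𝓝 t) := by
  have tendsto_root : Filter.Tendsto (fun r : ℕ => (c : ℝ) ^ (1 / (r : ℝ))) Filter.atTop (𝓝 1) := by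
    simpa only [Real.rpow_zero] using (tendsto_const_nhds (x := (c : ℝ))).rpow
      tendsto_one_div_atTop_nhds_zero_nat (Or.inl (NNReal.coe_pos.2 hc).ne')
  have tendsto_mul := tendsto_root.mul_const (t : ℝ)
  rw [one_mul] at tendsto_mul
  refine tendsto_mul.congr' ?_
  filter_upwards [Filter.eventually_ne_atTop 0] with r hr
  rw [NNReal.coe_mul, NNReal.coe_pow, Real.mul_rpow c.coe_nonneg (pow_nonneg t.coe_nonneg r),
    one_div, Real.pow_rpow_inv_natCast t.coe_nonneg hr]

theorem isHandelman_of_sq_eq {θ : ℝ} (hθ : 0 < θ) {i j : ℕ} (h : θ ^ 2 = i * θ + j) :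
    IsHandelman θ := by
  set P : Polynomial ℤ := Polynomial.X ^ 2 +
    (Polynomial.C (-(i : ℤ)) * Polynomial.X + Polynomial.C (-(j : ℤ))) with hP
  have natDegree_P : P.natDegree = 2 := by
    rw [hP]
    compute_degree!
  refine ⟨hθ, P, Polynomial.monic_X_pow_add Polynomial.degree_linear_lt, fun l hl => ?_, ?_⟩
  · rw [natDegree_P] at hl
    interval_cases l <;> simp [hP, Polynomial.coeff_X]
  · simp only [hP, map_add, map_mul, map_pow, map_neg, Polynomial.aeval_X, map_natCast, h]
    ring

theorem weight_mono {σ : Type*} {μ ν : σ → ℝ≥0} (h : μ ≤ ν) (m : σ →₀ ℕ) :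
    Finsupp.weight μ m ≤ Finsupp.weight ν m := by
  simp only [Finsupp.weight_apply, Finsupp.sum]
  exact Finset.sum_le_sum fun i _ => nsmul_le_nsmul_right (h i) _

theorem weight_const {σ : Type*} (a : ℝ≥0) (m : σ →₀ ℕ) :
    Finsupp.weight (fun _ => a) m = m.degree * a := by
  simp only [Finsupp.weight_apply, Finsupp.sum, Finsupp.degree_apply, Nat.cast_sum, nsmul_eq_mul,
    Finset.sum_mul]

namespace AffEnd

variable {k : Type*} [Field k] {n : ℕ} {f g : AffEnd k n} {θ : ℝ≥0}

theorem degree_le_iff {d : ℕ} : f.degree ≤ d ↔ ∀ i, (f i).totalDegree ≤ d := by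
  simp only [degree, Finset.sup_le_iff, Finset.mem_univ, true_imp_iff]

theorem totalDegree_le_degree (f : AffEnd k n) (i : Fin n) : (f i).totalDegree ≤ f.degree :=
  degree_le_iff.1 le_rfl i

theorem totalDegree_subst_le {d : ℕ} (hf : f.degree ≤ d) (P : MvPolynomial (Fin n) k) :
    (f.subst P).totalDegree ≤ d * P.totalDegree := by
  rw [← mem_weightLE_one_iff, Nat.cast_mul]
  refine bind₁_mem_weightLE (μ := 1) (fun i => ?_) (mem_weightLE_one_iff.2 le_rfl)
  simpa only [Pi.one_apply, mul_one] using mem_weightLE_one_iff.2 (degree_le_iff.1 hf i)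

theorem degree_mul_le (f g : AffEnd k n) : (f * g).degree ≤ f.degree * g.degree :=
  degree_le_iff.2 fun i => mul_comm f.degree g.degree ▸ (totalDegree_subst_le le_rfl _).trans
    (Nat.mul_le_mul_left _ (totalDegree_le_degree f i))

theorem one_le_degree_of_isUnit [NeZero n] (hf : IsUnit f) : 1 ≤ f.degree := by
  obtain ⟨g, hg⟩ := hf.exists_left_inv
  by_contra! h
  have hle := totalDegree_subst_le (Nat.lt_one_iff.1 h).le (g 0)
  rw [← mul_apply, hg, one_apply, totalDegree_X, zero_mul] at hle
  exact absurd hle (by norm_num)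

theorem exists_degree_pow_le_of_isConj (h : IsConj f g) :
    ∃ A : ℕ, ∀ r, (g ^ r).degree ≤ A * (f ^ r).degree := by
  obtain ⟨u, hu⟩ := h
  refine ⟨(u : AffEnd k n).degree * (↑u⁻¹ : AffEnd k n).degree, fun r => ?_⟩
  have pow_eq : g ^ r = u * f ^ r * ↑u⁻¹ :=
    (Units.eq_mul_inv_iff_mul_eq _).2 (hu.pow_right r).eq.symm
  calc (g ^ r).degree ≤ (u : AffEnd k n).degree * (f ^ r).degree * (↑u⁻¹ : AffEnd k n).degree :=
        pow_eq ▸ (degree_mul_le _ _).trans (Nat.mul_le_mul_right _ (degree_mul_le _ _))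
    _ = _ := mul_right_comm _ _ _

/-- `deg(f ^ r)` grows like `θ ^ r`, up to a constant factor from below and up to subexponential
factors from above. -/
def HasGrowth (f : AffEnd k n) (θ : ℝ≥0) : Prop :=
  (∀ δ : ℝ≥0, 0 < δ → ∃ K : ℝ≥0, 0 < K ∧ ∀ r, ((f ^ r).degree : ℝ≥0) ≤ K * (θ + δ) ^ r) ∧
    ∃ c : ℝ≥0, 0 < c ∧ ∀ r, c * θ ^ r ≤ ((f ^ r).degree : ℝ≥0)

theorem HasGrowth.hasDynamicalDegree (h : f.HasGrowth θ) : f.HasDynamicalDegree θ := by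
  have root_mono {s t : ℝ≥0} (hst : s ≤ t) (r : ℕ) :
      (s : ℝ) ^ (1 / (r : ℝ)) ≤ (t : ℝ) ^ (1 / (r : ℝ)) :=
    Real.rpow_le_rpow s.coe_nonneg (NNReal.coe_le_coe.2 hst) (by positivity)
  obtain ⟨hub, c, hc, hlb⟩ := h
  refine tendsto_order.2 ⟨fun b hb => ?_, fun b hb => ?_⟩
  · filter_upwards [(tendsto_const_mul_pow_rpow_inv hc θ).eventually (lt_mem_nhds hb)] with r hr
    exact hr.trans_le (root_mono (hlb r) r)
  · lift b to ℝ≥0 using θ.coe_nonneg.trans hb.le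
    obtain ⟨t, hθt, htb⟩ := exists_between (NNReal.coe_lt_coe.1 hb)
    obtain ⟨δ, rfl⟩ := exists_add_of_le hθt.le
    obtain ⟨K, hK, hle⟩ := hub δ (pos_of_lt_add_right hθt)
    filter_upwards [(tendsto_const_mul_pow_rpow_inv hK (θ + δ)).eventually
      (gt_mem_nhds (NNReal.coe_lt_coe.2 htb))] with r hr
    exact (root_mono (hle r) r).trans_lt hr

theorem HasGrowth.of_isConj (h : g.HasGrowth θ) (hc : IsConj f g) : f.HasGrowth θ := by
  obtain ⟨A, hA⟩ := exists_degree_pow_le_of_isConj hc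
  obtain ⟨B, hB⟩ := exists_degree_pow_le_of_isConj hc.symm
  obtain ⟨hub, c, hc, hlb⟩ := h
  constructor
  · intro δ hδ
    obtain ⟨K, hK, hle⟩ := hub δ hδ
    refine ⟨(B + 1) * K, by positivity, fun r => ?_⟩
    calc ((f ^ r).degree : ℝ≥0) ≤ B * (g ^ r).degree := mod_cast hB r
      _ ≤ (B + 1) * (K * (θ + δ) ^ r) := by gcongr; exacts [le_self_add, hle r]
      _ = _ := (mul_assoc _ _ _).symm
  · refine ⟨c / (A + 1), by positivity, fun r => ?_⟩
    rw [div_mul_eq_mul_div, div_le_iff₀ (by positivity)]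
    calc c * θ ^ r ≤ (g ^ r).degree := hlb r
      _ ≤ A * (f ^ r).degree := mod_cast hA r
      _ ≤ (f ^ r).degree * (A + 1) := by rw [mul_comm]; gcongr; exact le_self_add

theorem exists_degree_pow_le [NeZero n] {μ : Fin n → ℝ≥0} (hμ : ∀ i, 0 < μ i) {t : ℝ≥0}
    (h : ∀ i, f i ∈ weightLE k μ (t * μ i)) :
    ∃ K : ℝ≥0, 0 < K ∧ ∀ r, ((f ^ r).degree : ℝ≥0) ≤ K * t ^ r := by
  obtain ⟨a, ha⟩ := Finite.exists_min μ
  obtain ⟨b, hb⟩ := Finite.exists_max μ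
  refine ⟨μ b / μ a, div_pos (hμ b) (hμ a), fun r => ?_⟩
  have degree_mul_le_weight (i : Fin n) {m : Fin n →₀ ℕ} (hm : m ∈ ((f ^ r) i).support) :
      m.degree * μ a ≤ t ^ r * μ b :=
    calc m.degree * μ a = Finsupp.weight (fun _ => μ a) m := (weight_const _ m).symm
      _ ≤ Finsupp.weight μ m := weight_mono ha m
      _ ≤ t ^ r * μ i := mem_weightLE.1 (pow_apply_mem_weightLE h r i) m hm
      _ ≤ t ^ r * μ b := by gcongr; exact hb i
  rw [div_mul_eq_mul_div, le_div_iff₀ (hμ a), mul_comm (μ b)]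
  rw [← le_div_iff₀ (hμ a), ← Nat.le_floor_iff zero_le]
  refine degree_le_iff.2 fun i => Finset.sup_le fun m hm => ?_
  rw [Nat.le_floor_iff zero_le, le_div_iff₀ (hμ a)]
  exact degree_mul_le_weight i hm

theorem exists_le_degree_pow {μ : Fin n → ℝ≥0} {t : ℝ≥0} {i : Fin n} (hi : 0 < μ i)
    (h : ∀ r, ∃ m ∈ ((f ^ r) i).support, Finsupp.weight μ m = t ^ r * μ i) :
    ∃ c : ℝ≥0, 0 < c ∧ ∀ r, c * t ^ r ≤ ((f ^ r).degree : ℝ≥0) := by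
  have : Nonempty (Fin n) := ⟨i⟩
  obtain ⟨b, hb⟩ := Finite.exists_max μ
  have hb0 : 0 < μ b := hi.trans_le (hb i)
  refine ⟨μ i / μ b, div_pos hi hb0, fun r => ?_⟩
  obtain ⟨m, hm, hw⟩ := h r
  rw [div_mul_eq_mul_div, div_le_iff₀ hb0]
  calc μ i * t ^ r = Finsupp.weight μ m := by rw [hw, mul_comm]
    _ ≤ Finsupp.weight (fun _ => μ b) m := weight_mono hb m
    _ = m.degree * μ b := weight_const _ m
    _ ≤ (f ^ r).degree * μ b := by
      gcongr
      exact (le_totalDegree hm).trans (totalDegree_le_degree _ i)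

/-- The properties of a permutation-triangular model that concern its maximal eigenvalue `θ`. -/
structure HasStableEigenvalue (f : AffEnd k n) (θ : ℝ≥0) : Prop where
  isMaximalEigenvalue : f.IsMaximalEigenvalue θ
  stable : θ = 1 ∨ ∀ μ : Fin n → ℝ≥0, f.IsMaximalEigenvector μ → f.IsMuAlgStable μ
  growth : f.HasGrowth θ
  handelman : IsHandelman θ

/-- The `μ`-leading part of an endomorphism `f` with `deg_μ(fᵢ) ≤ θ μᵢ` for each `i`. -/
def leadingPart (μ : Fin n → ℝ≥0) (θ : ℝ≥0) (f : AffEnd k n) : AffEnd k n :=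
  fun i => weightedHomogeneousComponent μ (θ * μ i) (f i)

/-- Some coordinate of positive weight never vanishes along the iterates of the `μ`-leading
part of `f`. This forces `deg_μ(f ^ r) = θ ^ r` for all `r`. -/
def LeadingNonvanishing (μ : Fin n → ℝ≥0) (θ : ℝ≥0) (f : AffEnd k n) : Prop :=
  ∃ i, 0 < μ i ∧ ∀ r, (leadingPart μ θ f ^ r) i ≠ 0

theorem IsEigenvector.isLeadingForm_leadingPart {μ : Fin n → ℝ≥0} (h : f.IsEigenvector θ μ)
    (i : Fin n) : IsLeadingForm μ (θ * μ i) (f i) (leadingPart μ θ f i) :=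
  isLeadingForm_weightedHomogeneousComponent (h.mem_weightLE i)

theorem hasStableEigenvalue_of_leadingNonvanishing [NeZero n] (hf : IsUnit f) (h1 : 1 ≤ θ)
    {i j : ℕ} (hH : θ ^ 2 = i * θ + j)
    (hub : ∀ δ : ℝ≥0, 0 < δ → ∃ μ : Fin n → ℝ≥0, (∀ i, 0 < μ i) ∧
      ∀ i, f i ∈ weightLE k μ ((θ + δ) * μ i))
    (hE : ∃ μ : Fin n → ℝ≥0, μ ≠ 0 ∧ f.IsEigenvector θ μ)
    (hS : 1 < θ → ∀ μ : Fin n → ℝ≥0, μ ≠ 0 → f.IsEigenvector θ μ → LeadingNonvanishing μ θ f) :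
    HasStableEigenvalue f θ := by
  obtain ⟨ν, hν, hEν⟩ := hE
  have hmax := isMaximalEigenvalue_of_isEigenvector hub hν hEν
  have hθ : 0 < θ := zero_lt_one.trans_le h1
  refine ⟨hmax, ?_, ⟨fun δ hδ => ?_, ?_⟩, isHandelman_of_sq_eq (i := i) (j := j) hθ (mod_cast hH)⟩
  · rcases h1.eq_or_lt with h | h
    · exact Or.inl h.symm
    · refine Or.inr fun μ ⟨hμ, θ', hθ', (he : f.IsEigenvector θ' μ)⟩ => ?_
      obtain rfl : θ = θ' := hmax.unique hθ'
      obtain ⟨i, hi, hg⟩ := hS h μ hμ he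
      exact isMuAlgStable_of_isLeadingForm hθ he.isLeadingForm_leadingPart hi hg
  · obtain ⟨μ, hμ, h⟩ := hub δ hδ
    exact exists_degree_pow_le hμ h
  · rcases h1.eq_or_lt with rfl | h
    · exact ⟨1, one_pos, fun r => by simpa using mod_cast one_le_degree_of_isUnit (hf.pow r)⟩
    · obtain ⟨i, hi, hg⟩ := hS h ν hν hEν
      exact exists_le_degree_pow hi fun r =>
        (isLeadingForm_pow hθ hEν.isLeadingForm_leadingPart r i).exists_mem_support (hg r)

end AffEnd

/-! ### Substitutions with nonvanishing iterates -/

section Supported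

variable {R σ τ : Type*} [CommSemiring R]

theorem algHom_eq_of_mem_supported {A : Type*} [Semiring A] [Algebra R A]
    {F G : MvPolynomial σ R →ₐ[R] A} {s : Set σ} (h : ∀ i ∈ s, F (X i) = G (X i))
    {P : MvPolynomial σ R} (hP : P ∈ supported R s) : F P = G P :=
  AlgHom.adjoin_le_equalizer F G (Set.forall_mem_image.2 h) hP

theorem bind₁_mem_supported {g : σ → MvPolynomial τ R} {s : Set σ} {t : Set τ}
    (h : ∀ i ∈ s, g i ∈ supported R t) {P : MvPolynomial σ R} (hP : P ∈ supported R s) :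
    bind₁ g P ∈ supported R t :=
  Algebra.adjoin_le (S := (supported R t).comap (bind₁ g)) (Set.forall_mem_image.2 fun i hi =>
    show bind₁ g (X i) ∈ supported R t from (bind₁_X_right g i).symm ▸ h i hi) hP

theorem C_mem_supported (s : Set σ) (c : R) : C c ∈ supported R s :=
  Subalgebra.algebraMap_mem (supported R s) c

theorem C_mul_mem_supported {s : Set σ} (c : R) {P : MvPolynomial σ R} (hP : P ∈ supported R s) :
    C c * P ∈ supported R s :=
  mul_mem (C_mem_supported s c) hP

theorem mem_supported_iff_forall_support {s : Set σ} {P : MvPolynomial σ R} :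
    P ∈ supported R s ↔ ∀ m ∈ P.support, ∀ i ∉ s, m i = 0 := by
  simp only [mem_supported, Set.subset_def, Finset.mem_coe, mem_vars_iff_mem_support,
    Finsupp.mem_support_iff]
  grind

theorem exists_eq_aeval_of_mem_supported_singleton {i : σ} {P : MvPolynomial σ R}
    (hP : P ∈ supported R {i}) : ∃ Q : Polynomial R, P = Polynomial.aeval (X i) Q := by
  rw [supported_eq_adjoin_X, Set.image_singleton, Algebra.adjoin_singleton_eq_range_aeval] at hP
  obtain ⟨Q, hQ⟩ := hP
  exact ⟨Q, hQ.symm⟩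

end Supported

section ToUnivariate

variable {R σ : Type*} [CommSemiring R]

open Classical in
/-- A polynomial viewed as a polynomial in the single variable `X j`. The coefficients stay in the
full polynomial ring, where `X j` does not occur in them. -/
def toUnivariate (j : σ) : MvPolynomial σ R →ₐ[R] Polynomial (MvPolynomial σ R) :=
  aeval (Function.update (fun i => Polynomial.C (X i)) j Polynomial.X)

theorem toUnivariate_X_self (j : σ) : toUnivariate j (X j : MvPolynomial σ R) = Polynomial.X := by
  simp only [toUnivariate, aeval_X, Function.update_self]

theorem toUnivariate_X_of_ne {i j : σ} (h : i ≠ j) :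
    toUnivariate j (X i : MvPolynomial σ R) = Polynomial.C (X i) := by
  simp [toUnivariate, h]

theorem toUnivariate_C (j : σ) (c : R) : toUnivariate j (C c) = Polynomial.C (C c) :=
  aeval_C _ _

theorem eval_toUnivariate (j : σ) (P : MvPolynomial σ R) :
    (toUnivariate j P).eval (X j) = P := by
  induction P using MvPolynomial.induction_on with
  | C a => rw [toUnivariate_C, Polynomial.eval_C]
  | add p q hp hq => rw [map_add, Polynomial.eval_add, hp, hq]
  | mul_X p i hp =>
    rw [map_mul, Polynomial.eval_mul, hp]
    rcases eq_or_ne i j with rfl | h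
    · rw [toUnivariate_X_self, Polynomial.eval_X]
    · rw [toUnivariate_X_of_ne h, Polynomial.eval_C]

theorem toUnivariate_of_mem_supported {j : σ} {P : MvPolynomial σ R}
    (hP : P ∈ supported R {j}ᶜ) : toUnivariate j P = Polynomial.C P :=
  algHom_eq_of_mem_supported
    (G := (Algebra.ofId (MvPolynomial σ R) (Polynomial (MvPolynomial σ R))).restrictScalars R)
    (fun _ hi => toUnivariate_X_of_ne hi) hP

theorem coeff_toUnivariate_mem_supported [Nontrivial R] (j : σ) (P : MvPolynomial σ R) (r : ℕ) :
    (toUnivariate j P).coeff r ∈ supported R {j}ᶜ := by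
  induction P using MvPolynomial.induction_on generalizing r with
  | C a =>
    rw [toUnivariate_C, Polynomial.coeff_C]
    split_ifs
    exacts [C_mem_supported _ _, zero_mem _]
  | add p q hp hq =>
    rw [map_add, Polynomial.coeff_add]
    exact add_mem (hp r) (hq r)
  | mul_X p i hp =>
    rw [map_mul]
    rcases eq_or_ne i j with rfl | h
    · rw [toUnivariate_X_self]
      cases r with
      | zero => rw [Polynomial.coeff_mul_X_zero]; exact zero_mem _
      | succ r => rw [Polynomial.coeff_mul_X]; exact hp r
    · rw [toUnivariate_X_of_ne h, Polynomial.coeff_mul_C]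
      exact mul_mem (hp r) (X_mem_supported.2 h)

theorem natDegree_toUnivariate_ne_zero [Nontrivial R] {j : σ} {P : MvPolynomial σ R}
    (h : P ∉ supported R {j}ᶜ) : (toUnivariate j P).natDegree ≠ 0 := by
  refine fun h0 => h ?_
  rw [← eval_toUnivariate j P, Polynomial.eq_C_of_natDegree_eq_zero h0, Polynomial.eval_C]
  exact coeff_toUnivariate_mem_supported j P 0

theorem toUnivariate_bind₁ {g : σ → MvPolynomial σ R} {j : σ}
    (hg : ∀ i ≠ j, g i ∈ supported R {j}ᶜ) (P : MvPolynomial σ R) :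
    toUnivariate j (bind₁ g P) = ((toUnivariate j P).map
      (bind₁ g : MvPolynomial σ R →+* MvPolynomial σ R)).comp (toUnivariate j (g j)) := by
  induction P using MvPolynomial.induction_on with
  | C a => simp
  | add p q hp hq => simp only [map_add, hp, hq, Polynomial.map_add, Polynomial.add_comp]
  | mul_X p i hp =>
    simp only [map_mul, hp, Polynomial.map_mul, Polynomial.mul_comp, bind₁_X_right]
    congr 1
    rcases eq_or_ne i j with rfl | h
    · simp only [toUnivariate_X_self, Polynomial.map_X, Polynomial.X_comp]
    · simp [toUnivariate_X_of_ne h, toUnivariate_of_mem_supported (hg i h)]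

end ToUnivariate

section AlgebraicIndependence

variable {R σ : Type*} [CommRing R] [IsDomain R]

theorem transcendental_supported_of_notMem {j : σ} {P : MvPolynomial σ R}
    (h : P ∉ supported R {j}ᶜ) : Transcendental (supported R {j}ᶜ) P := by
  have transcendental_toUnivariate : Transcendental (MvPolynomial σ R) (toUnivariate j P) := by
    have hdeg := natDegree_toUnivariate_ne_zero h
    refine Polynomial.transcendental _ hdeg (mem_nonZeroDivisors_of_ne_zero ?_)
    rw [Polynomial.leadingCoeff_ne_zero]
    rintro h0
    exact hdeg (h0 ▸ Polynomial.natDegree_zero)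
  refine transcendental_toUnivariate.of_ringHom_of_comp_eq (supported R {j}ᶜ).val (toUnivariate j)
    Subtype.val_injective ?_
  exact RingHom.ext fun Q => (toUnivariate_of_mem_supported Q.2).symm

theorem transcendental_of_notMem_supported {j : σ} {P : MvPolynomial σ R}
    (h : P ∉ supported R {j}ᶜ) : Transcendental R P :=
  (transcendental_supported_of_notMem h).restrictScalars (FaithfulSMul.algebraMap_injective _ _)

end AlgebraicIndependence

section Iterate

variable {R σ : Type*} [CommRing R] {F : MvPolynomial σ R →ₐ[R] MvPolynomial σ R}

theorem eq_zero_of_algebraicIndepOn {s : Set σ} (h : AlgebraicIndepOn R (fun i => F (X i)) s)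
    {P : MvPolynomial σ R} (hP : P ∈ supported R s) (h0 : F P = 0) : P = 0 := by
  rw [supported_eq_range_rename] at hP
  obtain ⟨Q, rfl⟩ := hP
  have aeval_eq : aeval (fun i : s => F (X i)) Q = F (rename (↑) Q) :=
    DFunLike.congr_fun (algHom_ext fun i => by simp :
      aeval (fun i : s => F (X i)) = F.comp (rename (↑))) Q
  rw [h.eq_zero_of_aeval_eq_zero Q (aeval_eq.trans h0), map_zero]

theorem iterate_ne_zero_of_algebraicIndepOn {s : Set σ} (hs : ∀ i ∈ s, F (X i) ∈ supported R s)
    (hF : AlgebraicIndepOn R (fun i => F (X i)) s) {P : MvPolynomial σ R}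
    (hP : P ∈ supported R s) (h0 : P ≠ 0) (r : ℕ) : F^[r] P ≠ 0 := by
  induction r generalizing P with
  | zero => exact h0
  | succ _ ih =>
    refine ih (P := F P) ?_ fun h => h0 (eq_zero_of_algebraicIndepOn hF hP h)
    rw [show F P = bind₁ (fun i => F (X i)) P from DFunLike.congr_fun (aeval_unique F) P]
    exact bind₁_mem_supported hs hP

theorem algebraicIndepOn_pair [IsDomain R] {ι : Type*} {x : ι → MvPolynomial σ R} {a b : ι}
    {i j : σ} (hij : i ≠ j) (ha : x a ∈ supported R {i}) (hai : x a ∉ supported R {i}ᶜ)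
    (hbj : x b ∉ supported R {j}ᶜ) : AlgebraicIndepOn R x {a, b} := by
  refine Set.pair_comm a b ▸ AlgebraicIndepOn.insert ?_ ?_
  · exact (algebraicIndependent_singleton_iff ⟨a, rfl⟩).2 (transcendental_of_notMem_supported hai)
  · rw [Set.image_singleton]
    exact (transcendental_supported_of_notMem hbj).of_tower_top_of_subalgebra_le
      (Algebra.adjoin_le (Set.singleton_subset_iff.2
        (supported_mono (by simpa using hij.symm) ha)))

/-- The substitution may send `(Xᵢ, Xⱼ)` to `(u, v)` or to `(v, u)`. -/
theorem iterate_ne_zero_of_triangular [IsDomain R] {i j : σ} (hij : i ≠ j)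
    {u v : MvPolynomial σ R} (hu : u ∈ supported R {i}) (hui : u ∉ supported R {i}ᶜ)
    (hv : v ∈ supported R {i, j}) (hvj : v ∉ supported R {j}ᶜ)
    (hF : (F (X i) = u ∧ F (X j) = v) ∨ (F (X i) = v ∧ F (X j) = u)) {P : MvPolynomial σ R}
    (hP : P ∈ supported R {i, j}) (h0 : P ≠ 0) (r : ℕ) : F^[r] P ≠ 0 := by
  have hu' : u ∈ supported R {i, j} := supported_mono (by simp) hu
  refine iterate_ne_zero_of_algebraicIndepOn ?_ ?_ hP h0 r
  · rintro l (rfl | rfl) <;> rcases hF with ⟨h1, h2⟩ | ⟨h1, h2⟩ <;> simp only [h1, h2, hu', hv]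
  · rcases hF with ⟨rfl, rfl⟩ | ⟨rfl, rfl⟩
    · exact algebraicIndepOn_pair hij hu hui hvj
    · exact Set.pair_comm j i ▸ algebraicIndepOn_pair hij hu hui hvj

theorem iterate_ne_zero_of_transcendental {A : Type*} [CommRing A] [Algebra R A] [IsDomain R]
    {F : A →ₐ[R] A} {u : A} (hu : Transcendental R u) {Q : Polynomial R} (hQ : Q.natDegree ≠ 0)
    (hF : F u = Polynomial.aeval u Q) (r : ℕ) : F^[r] u ≠ 0 := by
  suffices h : ∀ P : Polynomial R, P ≠ 0 → F^[r] (Polynomial.aeval u P) ≠ 0 by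
    simpa only [Polynomial.aeval_X] using h Polynomial.X Polynomial.X_ne_zero
  induction r with
  | zero => exact fun P hP h => hP (transcendental_iff.1 hu P h)
  | succ r ih =>
    intro P hP
    rw [Function.iterate_succ_apply, ← Polynomial.aeval_algHom_apply, hF, ← Polynomial.aeval_comp]
    refine ih _ fun h => ?_
    rcases Polynomial.comp_eq_zero_iff.1 h with h | ⟨-, h⟩
    · exact hP h
    · exact hQ (by rw [h, Polynomial.natDegree_C])

end Iterate

/-! ### Affine-triangular automorphisms -/

section Bruhat

variable {ι K : Type*} [LinearOrder ι]

theorem exists_last_ne_zero [Finite ι] [Zero K] {w : ι → K} (hw : w ≠ 0) :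
    ∃ p, w p ≠ 0 ∧ ∀ j, p < j → w j = 0 := by
  obtain ⟨p, hp, hmax⟩ := Set.exists_max_image {j | w j ≠ 0} id (Set.toFinite _)
    (Function.ne_iff.1 hw)
  exact ⟨p, hp, fun j hj => not_not.1 fun h => hj.not_ge (hmax j h)⟩

theorem isUnit_of_isLowerTriangular [Fintype ι] [Field K] {L : Matrix ι ι K}
    (hL : L.IsLowerTriangular) (h : ∀ i, L i i ≠ 0) : IsUnit L := by
  rw [Matrix.isUnit_iff_isUnit_det, Matrix.det_of_isLowerTriangular L hL, isUnit_iff_ne_zero,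
    Finset.prod_ne_zero_iff]
  exact fun i _ => h i

/-- The row vector `w` ends in column `i` and the row vector `w * A` ends in column `p`, that is,
these are the columns of their last nonzero entries. -/
def IsPivot [Fintype ι] [NonUnitalNonAssocSemiring K] (A : Matrix ι ι K) (i p : ι) (w : ι → K) :
    Prop :=
  (w i ≠ 0 ∧ ∀ l, i < l → w l = 0) ∧ Matrix.vecMul w A p ≠ 0 ∧ ∀ l, p < l → Matrix.vecMul w A l = 0

theorem exists_isPivot [Fintype ι] [Field K] {A : Matrix ι ι K} (hA : IsUnit A) {i : ι} {w : ι → K}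
    (hi : w i ≠ 0) (hl : ∀ l, i < l → w l = 0) : ∃ p, IsPivot A i p w := by
  obtain ⟨p, hp⟩ := exists_last_ne_zero (w := Matrix.vecMul w A) fun h =>
    hi <| congrFun (Matrix.vecMul_injective_iff_isUnit.2 hA <|
      h.trans (Matrix.zero_vecMul A).symm) i
  exact ⟨p, ⟨hi, hl⟩, hp⟩

/-- Subtracting a multiple of the shorter row from the longer one cancels the common pivot. -/
theorem IsPivot.exists_lt [Fintype ι] [Field K] {A : Matrix ι ι K} (hA : IsUnit A) {i j p : ι}
    {u v : ι → K} (hu : IsPivot A i p u) (hv : IsPivot A j p v) (hij : i < j) :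
    ∃ q < p, ∃ w, IsPivot A j q w := by
  obtain ⟨⟨-, hui⟩, hup, hul⟩ := hu
  obtain ⟨⟨hvj, hvi⟩, -, hvl⟩ := hv
  set r := Matrix.vecMul v A p / Matrix.vecMul u A p
  obtain ⟨q, hq⟩ := exists_isPivot hA (i := j) (w := v - r • u) (by simp [hui j hij, hvj])
    fun l hl => by simp [hvi l hl, hui l (hij.trans hl)]
  have apply_eq (l : ι) :
      Matrix.vecMul (v - r • u) A l = Matrix.vecMul v A l - r * Matrix.vecMul u A l := by
    simp [Matrix.sub_vecMul, Matrix.smul_vecMul]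
  refine ⟨q, not_le.1 fun hpq => hq.2.1 ((apply_eq q).trans ?_), _, hq⟩
  rcases hpq.eq_or_lt with rfl | h
  · rw [div_mul_cancel₀ _ hup, sub_self]
  · rw [hvl q h, hul q h, mul_zero, sub_zero]

theorem exists_isLowerTriangular_mul_eq_submatrix [Fintype ι] [Field K]
    {A : Matrix ι ι K} (hA : IsUnit A) :
    ∃ (L R : Matrix ι ι K) (s : Equiv.Perm ι), L.IsLowerTriangular ∧ IsUnit L ∧
      R.IsLowerTriangular ∧ L * A = R.submatrix s id := by
  -- Each row of `L` is chosen so that the last nonzero entry of the corresponding row of `L * A`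
  -- lies as far to the left as possible. These entries then lie in distinct columns.
  have exists_minimal (i : ι) : ∃ p, Minimal (fun p => ∃ w, IsPivot A i p w) p := by
    refine exists_minimal_of_wellFoundedLT _ ?_
    obtain ⟨p, hp⟩ := exists_isPivot hA (i := i) (w := Pi.single i 1) (by simp)
      fun l hl => by simp [hl.ne']
    exact ⟨p, _, hp⟩
  choose s hs using exists_minimal
  choose (L : Matrix ι ι K) hL using fun i => (hs i).prop
  have injective_s : Function.Injective s := .of_lt_imp_ne fun i j hij hsij => by
    obtain ⟨q, hq, hw⟩ := (hL i).exists_lt hA (hsij ▸ hL j) hij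
    exact (hs j).not_lt hw (hsij ▸ hq)
  let e := Equiv.ofBijective s (Finite.injective_iff_bijective.1 injective_s)
  have hL' : L.IsLowerTriangular := fun i j hij => (hL i).1.2 j hij
  refine ⟨L, (L * A).submatrix e.symm id, e, hL',
    isUnit_of_isLowerTriangular hL' fun i => (hL i).1.1, ?_, ?_⟩
  · exact fun i j hij => (hL (e.symm i)).2.2 j ((e.apply_symm_apply i).trans_lt hij)
  · simp [Matrix.submatrix_submatrix]

end Bruhat

namespace AffEnd

variable {k : Type*} [Field k] {n : ℕ}

section Elementary

theorem subst_mem_supported {f : AffEnd k n} {s t : Set (Fin n)}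
    (h : ∀ i ∈ s, f i ∈ supported k t) {P : MvPolynomial (Fin n) k} (hP : P ∈ supported k s) :
    f.subst P ∈ supported k t :=
  bind₁_mem_supported h hP

theorem pow_apply_eq_iterate (f : AffEnd k n) (r : ℕ) (i : Fin n) :
    (f ^ r) i = f.subst^[r] (X i) := by
  induction r with
  | zero => rfl
  | succ r ih => rw [pow_succ_apply, ih, Function.iterate_succ_apply']

/-- The elementary endomorphism replacing the `j`-th coordinate by `c Xⱼ + q`. -/
def elementary (j : Fin n) (c : k) (q : MvPolynomial (Fin n) k) : AffEnd k n :=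
  ofFun (Function.update X j (C c * X j + q))

theorem elementary_self (j : Fin n) (c : k) (q : MvPolynomial (Fin n) k) :
    elementary j c q j = C c * X j + q := by
  simp [elementary]

theorem elementary_of_ne {i j : Fin n} (h : i ≠ j) (c : k) (q : MvPolynomial (Fin n) k) :
    elementary j c q i = X i := by
  simp [elementary, h]

theorem subst_elementary_of_mem_supported {j : Fin n} (c : k) (q : MvPolynomial (Fin n) k)
    {P : MvPolynomial (Fin n) k} (hP : P ∈ supported k {j}ᶜ) : (elementary j c q).subst P = P :=
  algHom_eq_of_mem_supported (G := AlgHom.id k _)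
    (fun i hi => by rw [subst_X, elementary_of_ne hi]; rfl) hP

theorem elementary_mul_elementary {j : Fin n} {c c' : k} (hc : c * c' = 1)
    {q : MvPolynomial (Fin n) k} (hq : q ∈ supported k {j}ᶜ) :
    elementary j c q * elementary j c' (-(C c' * q)) = 1 := by
  have hcc : (C c * C c' : MvPolynomial (Fin n) k) = 1 := by rw [← C_mul, hc, C_1]
  funext i
  rw [mul_apply, one_apply]
  rcases eq_or_ne i j with rfl | h
  · rw [elementary_self, map_add, map_mul, subst_C, subst_X, elementary_self,
      subst_elementary_of_mem_supported _ _ hq]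
    linear_combination (X i - q) * hcc
  · rw [elementary_of_ne h, subst_X, elementary_of_ne h]

theorem elementary_mul_elementary' {j : Fin n} {c c' : k} (hc : c * c' = 1)
    {q : MvPolynomial (Fin n) k} (hq : q ∈ supported k {j}ᶜ) :
    elementary j c' (-(C c' * q)) * elementary j c q = 1 := by
  have hcc : (C c * C c' : MvPolynomial (Fin n) k) = 1 := by rw [← C_mul, hc, C_1]
  have h := elementary_mul_elementary (j := j) ((mul_comm c' c).trans hc)
    (neg_mem (C_mul_mem_supported c' hq))
  rwa [show -(C c * -(C c' * q)) = q by linear_combination q * hcc] at h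

theorem isUnit_elementary (j : Fin n) {c : k} (hc : c ≠ 0) {q : MvPolynomial (Fin n) k}
    (hq : q ∈ supported k {j}ᶜ) : IsUnit (elementary j c q) :=
  isUnit_iff_exists.2 ⟨_, elementary_mul_elementary (mul_inv_cancel₀ hc) hq,
    elementary_mul_elementary' (mul_inv_cancel₀ hc) hq⟩

theorem exists_eq_C_mul_X_add {f : AffEnd k n} (hf : IsUnit f) {j : Fin n}
    (h : ∀ i ≠ j, f i ∈ supported k {j}ᶜ) :
    ∃ e : k, e ≠ 0 ∧ ∃ q ∈ supported k {j}ᶜ, f j = C e * X j + q := by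
  obtain ⟨g, hg⟩ := hf.exists_left_inv
  have X_eq_comp : Polynomial.X = ((toUnivariate j (g j)).map
      (f.subst : MvPolynomial (Fin n) k →+* MvPolynomial (Fin n) k)).comp
        (toUnivariate j (f j)) := by
    rw [← toUnivariate_X_self, ← one_apply j, ← hg, mul_apply]
    exact toUnivariate_bind₁ h (g j)
  have natDegree_eq := congrArg Polynomial.natDegree X_eq_comp
  rw [Polynomial.natDegree_X, Polynomial.natDegree_comp, eq_comm] at natDegree_eq
  have natDegree_g := Nat.eq_one_of_mul_eq_one_right natDegree_eq
  have natDegree_f := Nat.eq_one_of_mul_eq_one_left natDegree_eq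
  have leadingCoeff_eq := congrArg Polynomial.leadingCoeff X_eq_comp
  rw [Polynomial.leadingCoeff_X, Polynomial.leadingCoeff_comp (by omega), natDegree_g,
    pow_one] at leadingCoeff_eq
  obtain ⟨e, he, leadingCoeff_f⟩ := isUnit_iff_eq_C_of_isReduced.1
    (IsUnit.of_mul_eq_one_right _ leadingCoeff_eq.symm)
  refine ⟨e, he.ne_zero, _, coeff_toUnivariate_mem_supported j (f j) 0, ?_⟩
  rw [Polynomial.leadingCoeff, natDegree_f] at leadingCoeff_f
  conv_lhs => rw [← eval_toUnivariate j (f j),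
    Polynomial.eq_X_add_C_of_natDegree_le_one natDegree_f.le, leadingCoeff_f]
  simp

end Elementary

section Triangular

theorem IsTriangular.mul {f g : AffEnd k n} (hf : f.IsTriangular) (hg : g.IsTriangular) :
    (f * g).IsTriangular := by
  intro i
  rw [mul_apply]
  exact subst_mem_supported (fun j hj => supported_mono (Set.Iic_subset_Iic.2 hj) (hg j)) (hf i)

theorem isUnit_ite_X {f : AffEnd k n} (hf : IsUnit f) {j : Fin n} {e : k} (he : e ≠ 0)
    {q : MvPolynomial (Fin n) k} (hq : q ∈ supported k {j}ᶜ)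
    (h : ∀ i ≠ j, f i ∈ supported k {j}ᶜ) (hj : f j = C e * X j + q) :
    IsUnit (ofFun fun i => if i = j then X j else f i) := by
  suffices heq : f = (ofFun fun i => if i = j then X j else f i) * elementary j e q by
    rw [heq] at hf
    exact (isUnit_elementary j he hq).mul_right_iff.1 hf
  funext i
  rw [mul_apply, ofFun_apply]
  rcases eq_or_ne i j with rfl | hi
  · rw [if_pos rfl, subst_X, elementary_self, hj]
  · rw [if_neg hi, subst_elementary_of_mem_supported _ _ (h i hi)]

/-- The endomorphism keeping the coordinates of `f` of index below `m` and replacing the others by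
variables. -/
def truncate (f : AffEnd k n) (m : ℕ) : AffEnd k n :=
  ofFun fun i => if i.val < m then f i else X i

theorem IsTriangular.truncate_mem_supported {f : AffEnd k n} (hf : f.IsTriangular) {i j : Fin n}
    (hij : i ≠ j) : f.truncate (j + 1) i ∈ supported k {j}ᶜ := by
  simp only [truncate, ofFun_apply]
  split_ifs with hi
  · have hij' : i < j := lt_of_le_of_ne (Fin.le_def.2 (Nat.le_of_lt_succ hi)) hij
    exact supported_mono (fun l (hl : l ≤ i) => (hl.trans_lt hij').ne) (hf i)
  · exact X_mem_supported.2 hij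

theorem truncate_eq_ite (f : AffEnd k n) (j : Fin n) :
    f.truncate j = ofFun fun i => if i = j then X j else f.truncate (j + 1) i := by
  funext i
  rcases eq_or_ne i j with rfl | hij
  · simp [truncate]
  · have : i.val ≠ j.val := Fin.val_ne_of_ne hij
    simp only [truncate, ofFun_apply, if_neg hij]
    congr 1
    exact propext ⟨by omega, by omega⟩

theorem IsTriangular.isUnit_truncate {f : AffEnd k n} (ht : f.IsTriangular) (hf : IsUnit f)
    {m : ℕ} (hm : m ≤ n) : IsUnit (f.truncate m) := by
  induction hm using Nat.decreasingInduction with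
  | self => rwa [show f.truncate n = f from funext fun i => if_pos i.2]
  | of_succ m hm ih =>
    have hsupp (i : Fin n) (hi : i ≠ ⟨m, hm⟩) := ht.truncate_mem_supported hi
    obtain ⟨e, he, q, hq, heq⟩ := exists_eq_C_mul_X_add ih hsupp
    exact truncate_eq_ite f ⟨m, hm⟩ ▸ isUnit_ite_X ih he hq hsupp heq

theorem IsTriangular.exists_eq_C_mul_X_add {f : AffEnd k n} (ht : f.IsTriangular) (hf : IsUnit f)
    (j : Fin n) : ∃ e : k, e ≠ 0 ∧ ∃ q ∈ supported k (Set.Iio j), f j = C e * X j + q := by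
  obtain ⟨e, he, q, hq, heq⟩ := AffEnd.exists_eq_C_mul_X_add
    (ht.isUnit_truncate hf (m := j + 1) j.2) fun i => ht.truncate_mem_supported
  have f_eq : f j = C e * X j + q := by simpa [truncate] using heq
  refine ⟨e, he, q, ?_, f_eq⟩
  have q_mem : q ∈ supported k (Set.Iic j) := by
    rw [eq_sub_of_add_eq' f_eq.symm]
    exact sub_mem (ht j) (C_mul_mem_supported _ (X_mem_supported.2 (Set.mem_Iic.2 le_rfl)))
  rw [mem_supported] at q_mem hq ⊢
  exact fun i hi => lt_of_le_of_ne (q_mem hi) (hq hi)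

end Triangular

section Affine

/-- The affine endomorphism `x ↦ A x + v`. -/
def aff (A : Matrix (Fin n) (Fin n) k) (v : Fin n → k) : AffEnd k n :=
  ofFun fun i => ∑ j, C (A i j) * X j + C (v i)

theorem aff_apply (A : Matrix (Fin n) (Fin n) k) (v : Fin n → k) (i : Fin n) :
    aff A v i = ∑ j, C (A i j) * X j + C (v i) :=
  rfl

theorem aff_mul_aff (A B : Matrix (Fin n) (Fin n) k) (v w : Fin n → k) :
    aff A v * aff B w = aff (A * B) (A.mulVec w + v) := by
  funext i
  simp only [mul_apply, aff_apply, map_add, map_sum, map_mul, subst_C, subst_X, Matrix.mul_apply,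
    Matrix.mulVec, dotProduct, Pi.add_apply, mul_add, Finset.sum_add_distrib, Finset.sum_mul,
    Finset.mul_sum]
  rw [Finset.sum_comm]
  simp only [mul_assoc, add_assoc]

theorem aff_one_zero : aff (1 : Matrix (Fin n) (Fin n) k) 0 = 1 := by
  funext i
  simp [aff_apply, one_apply, Matrix.one_apply]

theorem degree_aff_le (A : Matrix (Fin n) (Fin n) k) (v : Fin n → k) : (aff A v).degree ≤ 1 := by
  refine degree_le_iff.2 fun i => (totalDegree_add _ _).trans (max_le ?_ (by simp))
  exact (totalDegree_finsetSum _ _).trans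
    (Finset.sup_le fun j _ => (totalDegree_mul _ _).trans (by simp))

theorem eq_aff_of_degree_le_one {f : AffEnd k n} (hf : f.degree ≤ 1) : ∃ A v, f = aff A v := by
  refine ⟨Matrix.of fun i j => coeff (Finsupp.single j 1) (f i), fun i => coeff 0 (f i), ?_⟩
  funext i
  ext m
  simp only [aff_apply, Matrix.of_apply, coeff_add, coeff_sum, coeff_C_mul, coeff_X, coeff_C]
  have single_ne_zero (j : Fin n) : (0 : Fin n →₀ ℕ) ≠ Finsupp.single j 1 :=
    (Finsupp.single_ne_zero.2 one_ne_zero).symm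
  rcases lt_trichotomy m.degree 1 with h | h | h
  · obtain rfl := (Finsupp.degree_eq_zero_iff m).1 (Nat.lt_one_iff.1 h)
    simp
  · obtain ⟨j, rfl⟩ : m ∈ Set.range fun j : Fin n => Finsupp.single j 1 :=
      Finsupp.range_single_one ▸ h
    simp [Finsupp.single_left_inj, single_ne_zero]
  · have coeff_eq_zero : coeff m (f i) = 0 := by
      by_contra hne
      exact h.not_ge ((le_totalDegree (mem_support_iff.2 hne)).trans (degree_le_iff.1 hf i))
    have ne_single (j : Fin n) : Finsupp.single j 1 ≠ m := by
      rintro rfl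
      simp at h
    have ne_zero : 0 ≠ m := by
      rintro rfl
      simp at h
    simp [coeff_eq_zero, ne_single, ne_zero]

theorem coeff_single_aff (A : Matrix (Fin n) (Fin n) k) (v : Fin n → k) (i j : Fin n) :
    coeff (Finsupp.single j 1) (aff A v i) = A i j := by
  simp [aff_apply, coeff_sum, coeff_C_mul, coeff_X, Finsupp.single_left_inj, coeff_C,
    (Finsupp.single_ne_zero.2 one_ne_zero : Finsupp.single j 1 ≠ 0).symm]

theorem isUnit_of_isUnit_aff {A : Matrix (Fin n) (Fin n) k} {v : Fin n → k}
    (h : IsUnit (aff A v)) : IsUnit A := by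
  obtain ⟨g, hg⟩ := h.exists_right_inv
  rw [Matrix.isUnit_iff_isUnit_det, isUnit_iff_ne_zero]
  refine fun hdet => ?_
  obtain ⟨w, hw, hwA⟩ := Matrix.exists_vecMul_eq_zero_iff.2 hdet
  let W : Matrix (Fin n) (Fin n) k := Matrix.of fun _ => w
  have aff_const_mul (c : Fin n → k) : aff 0 c * g = aff 0 c := by
    funext i
    simp [mul_apply, aff_apply]
  have aff_W : aff W 0 = aff 0 (W.mulVec v) := by
    rw [← mul_one (aff W 0), ← hg, ← mul_assoc, aff_mul_aff, add_zero,
      show W * A = 0 from Matrix.ext fun _ j => congrFun hwA j, aff_const_mul]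
  refine hw (funext fun j => ?_)
  calc w j = coeff (Finsupp.single j 1) (aff W 0 j) := (coeff_single_aff W 0 j j).symm
    _ = 0 := by rw [aff_W, coeff_single_aff, Matrix.zero_apply]

theorem isTriangular_aff {L : Matrix (Fin n) (Fin n) k} (hL : L.IsLowerTriangular)
    (v : Fin n → k) : (aff L v).IsTriangular := by
  intro i
  refine add_mem (sum_mem fun j _ => ?_) (C_mem_supported _ _)
  rcases lt_or_ge i j with h | h
  · rw [hL h, C_0, zero_mul]
    exact zero_mem _
  · exact C_mul_mem_supported _ (X_mem_supported.2 h)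

end Affine

section Permutation

theorem isUnit_of_isConj {M : Type*} [Monoid M] {f g : M} (h : IsConj f g) (hf : IsUnit f) :
    IsUnit g := by
  obtain ⟨u, hu⟩ := h
  exact u.isUnit.mul_right_iff.1 (hu.eq ▸ u.isUnit.mul hf)

theorem IsAffineTriangular.exists_isConj {f : AffEnd k n} (hf : f.IsAffineTriangular) :
    ∃ (s : Equiv.Perm (Fin n)) (t : AffEnd k n), t.IsTriangular ∧
      IsConj f (ofFun fun i => t (s i)) ∧ (ofFun fun i => t (s i)).degree ≤ f.degree := by
  obtain ⟨α, τ, ⟨hα, hα1⟩, hτ, rfl⟩ := hf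
  obtain ⟨A, v, rfl⟩ := eq_aff_of_degree_le_one hα1.le
  obtain ⟨L, R, s, hL, hLu, hR, hLA⟩ :=
    exists_isLowerTriangular_mul_eq_submatrix (isUnit_of_isUnit_aff hα)
  have hLdet := (Matrix.isUnit_iff_isUnit_det L).1 hLu
  have hLi : L⁻¹.IsLowerTriangular := by
    let _ := hLu.invertible
    exact Matrix.blockTriangular_inv_of_blockTriangular hL
  have aff_mul_inv : aff L 0 * aff L⁻¹ 0 = 1 := by
    rw [aff_mul_aff, Matrix.mul_nonsing_inv L hLdet, Matrix.mulVec_zero, add_zero, aff_one_zero]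
  have inv_mul_aff : aff L⁻¹ 0 * aff L 0 = 1 := by
    rw [aff_mul_aff, Matrix.nonsing_inv_mul L hLdet, Matrix.mulVec_zero, add_zero, aff_one_zero]
  set g := aff L 0 * (aff A v * τ) * aff L⁻¹ 0 with hg
  let t := aff R (L.mulVec v ∘ s.symm) * τ * aff L⁻¹ 0
  have t_eq : (ofFun fun i => t (s i)) = g := by
    funext i
    rw [hg, ← mul_assoc (aff L 0), aff_mul_aff, add_zero, hLA]
    simp only [t, ofFun_apply, mul_apply, aff_apply, Function.comp_apply, Equiv.symm_apply_apply,
      Matrix.submatrix_apply, id]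
  refine ⟨s, t, ((isTriangular_aff hR _).mul hτ).mul (isTriangular_aff hLi 0), t_eq ▸ ?_,
    t_eq ▸ ?_⟩
  · refine ⟨⟨aff L 0, aff L⁻¹ 0, aff_mul_inv, inv_mul_aff⟩, ?_⟩
    change aff L 0 * (aff A v * τ) = g * aff L 0
    rw [hg, mul_assoc _ (aff L⁻¹ 0), inv_mul_aff, mul_one]
  · calc g.degree ≤ 1 * (aff A v * τ).degree * 1 :=
          (degree_mul_le _ _).trans (Nat.mul_le_mul ((degree_mul_le _ _).trans
            (Nat.mul_le_mul_right _ (degree_aff_le L 0))) (degree_aff_le L⁻¹ 0))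
      _ = (aff A v * τ).degree := by rw [one_mul, mul_one]

end Permutation

end AffEnd

/-! ### Transcendence of leading forms -/

section LeadingForms

variable {R σ : Type*} {μ : σ → ℝ≥0} {w : ℝ≥0}

section CommSemiring

variable [CommSemiring R] {P : MvPolynomial σ R}

theorem weightedHomogeneousComponent_mem_supported {s : Set σ} (hP : P ∈ supported R s) :
    weightedHomogeneousComponent μ w P ∈ supported R s := by
  classical
  refine mem_supported_iff_forall_support.2 fun m hm => mem_supported_iff_forall_support.1 hP m ?_
  rw [support_weightedHomogeneousComponent] at hm
  exact (Finset.mem_filter.1 hm).1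

theorem weightedHomogeneousComponent_ne_zero (h : weightedTotalDegree μ P = w) (hw : w ≠ 0) :
    weightedHomogeneousComponent μ w P ≠ 0 := by
  classical
  have hP : P.support.Nonempty := by
    rw [Finset.nonempty_iff_ne_empty]
    rintro h0
    exact hw (by rw [← h, weightedTotalDegree, h0, Finset.sup_empty, bot_eq_zero])
  obtain ⟨m, hm, hmw⟩ := Finset.exists_mem_eq_sup _ hP (Finsupp.weight μ)
  refine ne_zero_iff.2 ⟨m, ?_⟩
  rw [coeff_weightedHomogeneousComponent, if_pos (hmw.symm.trans h)]
  exact mem_support_iff.1 hm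

theorem weightedHomogeneousComponent_zero_eq_self (h : weightedTotalDegree μ P = 0) :
    weightedHomogeneousComponent μ 0 P = P := by
  refine IsWeightedHomogeneous.weightedHomogeneousComponent_same fun m hm => ?_
  exact nonpos_iff_eq_zero.1 (h ▸ le_weightedTotalDegree μ (mem_support_iff.2 hm))

theorem weightedHomogeneousComponent_C_mul_X (e : R) (j : σ) :
    weightedHomogeneousComponent μ w (C e * X j : MvPolynomial σ R) =
      if μ j = w then C e * X j else 0 := by
  split_ifs with h
  · subst h
    exact ((isWeightedHomogeneous_X R μ j).C_mul e).weightedHomogeneousComponent_same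
  · exact ((isWeightedHomogeneous_X R μ j).C_mul e).weightedHomogeneousComponent_ne w (Ne.symm h)

theorem weightedTotalDegree_add_smul_le (μ ν : σ → ℝ≥0) (ε : ℝ≥0) (P : MvPolynomial σ R) :
    weightedTotalDegree (μ + ε • ν) P ≤
      weightedTotalDegree μ P + ε * weightedTotalDegree ν P := by
  refine Finset.sup_le fun m hm => ?_
  have weight_add_smul : Finsupp.weight (μ + ε • ν) m =
      Finsupp.weight μ m + ε * Finsupp.weight ν m := by
    simp only [Finsupp.weight_apply, Finsupp.sum, Finset.mul_sum, ← Finset.sum_add_distrib,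
      Pi.add_apply, Pi.smul_apply, smul_eq_mul, smul_add, mul_smul_comm]
  rw [weight_add_smul]
  gcongr
  exacts [le_weightedTotalDegree μ hm, le_weightedTotalDegree ν hm]

theorem support_C_mul_X_add [DecidableEq σ] {e : R} (he : e ≠ 0) {j : σ} {q : MvPolynomial σ R}
    (hq : q ∈ supported R {j}ᶜ) :
    (C e * X j + q).support = insert (Finsupp.single j 1) q.support := by
  have coeff_single : coeff (Finsupp.single j 1) q = 0 := by
    by_contra h
    simpa using mem_supported_iff_forall_support.1 hq _ (mem_support_iff.2 h) j (by simp)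
  ext m
  rw [Finset.mem_insert, mem_support_iff, mem_support_iff, coeff_add, coeff_C_mul, coeff_X]
  by_cases h : m = Finsupp.single j 1
  · simp [h, coeff_single, he]
  · simp [h, Ne.symm h]

theorem C_mul_X_add_notMem_supported {e : R} (he : e ≠ 0) {j : σ} {q : MvPolynomial σ R}
    (hq : q ∈ supported R {j}ᶜ) : C e * X j + q ∉ supported R {j}ᶜ := by
  classical
  intro h
  simpa using mem_supported_iff_forall_support.1 h (Finsupp.single j 1)
    (support_C_mul_X_add he hq ▸ Finset.mem_insert_self _ _) j (by simp)

theorem weightedTotalDegree_C_mul_X_add {e : R} (he : e ≠ 0) {j : σ} {q : MvPolynomial σ R}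
    (hq : q ∈ supported R {j}ᶜ) :
    weightedTotalDegree μ (C e * X j + q) = max (μ j) (weightedTotalDegree μ q) := by
  classical
  rw [weightedTotalDegree, support_C_mul_X_add he hq, Finset.sup_insert, Finsupp.weight_single,
    one_smul]
  rfl

theorem aeval_mem_supported {s : Set σ} {Q : MvPolynomial σ R} (hQ : Q ∈ supported R s)
    (p : Polynomial R) : Polynomial.aeval Q p ∈ supported R s :=
  Polynomial.coe_aeval_mk_apply Q hQ ▸ (Polynomial.aeval (⟨Q, hQ⟩ : supported R s) p).2

theorem aeval_X_mem_supported (i : σ) (p : Polynomial R) :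
    Polynomial.aeval (X i : MvPolynomial σ R) p ∈ supported R {i} := by
  rw [supported_eq_adjoin_X, Set.image_singleton]
  exact Polynomial.aeval_mem_adjoin_singleton R _

theorem aeval_eq_sum (Q : MvPolynomial σ R) (p : Polynomial R) :
    Polynomial.aeval Q p = ∑ l ∈ p.support, C (p.coeff l) * Q ^ l := by
  rw [Polynomial.aeval_def, Polynomial.eval₂_eq_sum, Polynomial.sum]
  rfl

theorem coeff_single_aeval_X (i : σ) (p : Polynomial R) (l : ℕ) :
    coeff (Finsupp.single i l) (Polynomial.aeval (X i : MvPolynomial σ R) p) = p.coeff l := by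
  classical
  simp only [aeval_eq_sum, coeff_sum, coeff_C_mul, coeff_X_pow,
    (Finsupp.single_injective i).eq_iff, mul_ite, mul_one, mul_zero, Finset.sum_ite_eq',
    Polynomial.mem_support_iff]
  split_ifs with h
  exacts [rfl, (not_not.1 h).symm]

theorem aeval_mem_weightLE {Q : MvPolynomial σ R} (hQ : Q ∈ weightLE R μ w) (p : Polynomial R) :
    Polynomial.aeval Q p ∈ weightLE R μ (p.natDegree * w) := by
  rw [aeval_eq_sum]
  refine sum_mem fun l hl => C_mul_mem _ (weightLE_mono ?_ (pow_mem_weightLE hQ l))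
  rw [nsmul_eq_mul]
  gcongr
  exact Polynomial.le_natDegree_of_mem_supp l hl

theorem weightedTotalDegree_aeval_X (i : σ) (p : Polynomial R) :
    weightedTotalDegree μ (Polynomial.aeval (X i : MvPolynomial σ R) p) = p.natDegree * μ i := by
  refine le_antisymm (mem_weightLE_iff_weightedTotalDegree_le.1
    (aeval_mem_weightLE (X_mem_weightLE i) p)) ?_
  rcases eq_or_ne p 0 with rfl | hp
  · simp
  · have hm : Finsupp.single i p.natDegree ∈
        (Polynomial.aeval (X i : MvPolynomial σ R) p).support :=
      mem_support_iff.2 <| by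
        rwa [coeff_single_aeval_X, Polynomial.coeff_natDegree, Polynomial.leadingCoeff_ne_zero]
    simpa only [Finsupp.weight_single, nsmul_eq_mul] using le_weightedTotalDegree μ hm

theorem aeval_X_eq_eraseLead_add (i : σ) (p : Polynomial R) :
    Polynomial.aeval (X i : MvPolynomial σ R) p =
      Polynomial.aeval (X i) p.eraseLead + C p.leadingCoeff * X i ^ p.natDegree := by
  conv_lhs => rw [← Polynomial.eraseLead_add_C_mul_X_pow p]
  rw [map_add, map_mul, Polynomial.aeval_C, map_pow, Polynomial.aeval_X]
  rfl

theorem aeval_X_eraseLead_mem_weightLT {i : σ} (hi : 0 < μ i) (p : Polynomial R) :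
    Polynomial.aeval (X i : MvPolynomial σ R) p.eraseLead ∈ weightLT R μ (p.natDegree * μ i) := by
  rw [aeval_eq_sum]
  refine sum_mem fun l hl => C_mul_mem _ (mem_weightLT.2 fun m hm => ?_)
  refine (mem_weightLE.1 (pow_mem_weightLE (X_mem_weightLE i) l) m hm).trans_lt ?_
  rw [nsmul_eq_mul]
  gcongr
  exact Polynomial.lt_natDegree_of_mem_eraseLead_support hl

end CommSemiring

section CommRing

variable [CommRing R] {P P₀ : MvPolynomial σ R}

theorem IsLeadingForm.weightedHomogeneousComponent_eq (h : IsLeadingForm μ w P P₀) :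
    weightedHomogeneousComponent μ w P = P₀ := by
  classical
  refine MvPolynomial.ext _ _ fun m => ?_
  rw [coeff_weightedHomogeneousComponent]
  split_ifs with hm
  · exact h.coeff_eq hm
  · by_contra h0
    exact hm (h.1 (Ne.symm h0))

theorem isLeadingForm_aeval_X {i : σ} (hi : 0 < μ i) (p : Polynomial R) :
    IsLeadingForm μ (p.natDegree * μ i) (Polynomial.aeval (X i) p)
      (C p.leadingCoeff * X i ^ p.natDegree) := by
  refine ⟨?_, ?_⟩
  · rw [← nsmul_eq_mul]
    exact ((isWeightedHomogeneous_X R μ i).pow p.natDegree).C_mul p.leadingCoeff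
  · rw [aeval_X_eq_eraseLead_add, add_sub_cancel_right]
    exact aeval_X_eraseLead_mem_weightLT hi p

theorem notMem_supported_of_isWeightedHomogeneous (hP : IsWeightedHomogeneous μ P w) (h0 : P ≠ 0)
    (hw : w ≠ 0) {s t : Set σ} (hs : P ∈ supported R s) (hμ : ∀ i ∈ s, i ∈ t → μ i = 0) :
    P ∉ supported R t := by
  intro ht
  obtain ⟨m, hm⟩ := ne_zero_iff.1 h0
  refine hw ((hP hm).symm.trans ?_)
  rw [Finsupp.weight_apply]
  refine Finset.sum_eq_zero fun i hi => ?_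
  have mem_of_mem_supported {u : Set σ} (hu : P ∈ supported R u) : i ∈ u := by
    by_contra hiu
    exact Finsupp.mem_support_iff.1 hi
      (mem_supported_iff_forall_support.1 hu m (mem_support_iff.2 hm) i hiu)
  change m i • μ i = 0
  rw [hμ i (mem_of_mem_supported hs) (mem_of_mem_supported ht), smul_zero]

theorem transcendental_of_isWeightedHomogeneous [IsDomain R] (hP : IsWeightedHomogeneous μ P w)
    (h0 : P ≠ 0) (hw : w ≠ 0) : Transcendental R P := by
  obtain ⟨m, hm⟩ := ne_zero_iff.1 h0
  have hm0 : m ≠ 0 := by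
    rintro rfl
    exact hw ((hP hm).symm.trans (map_zero _))
  obtain ⟨i, hi⟩ := Finsupp.ne_iff.1 hm0
  exact transcendental_of_notMem_supported (j := i) fun h =>
    hi (mem_supported_iff_forall_support.1 h m (mem_support_iff.2 hm) i (by simp))

/-- If `h` involves `Xⱼ`, then `h` and `u` are algebraically independent; otherwise `F` restricts to
an injective substitution in `Xᵢ` alone. -/
theorem iterate_X_ne_zero_of_transcendental [IsDomain R]
    {F : MvPolynomial σ R →ₐ[R] MvPolynomial σ R} {i j : σ} (hij : i ≠ j) {h u : MvPolynomial σ R}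
    (hh : h ∈ supported R {i, j}) (htr : Transcendental R h) (hu : u ∈ supported R {i})
    (hui : u ∉ supported R {i}ᶜ) (hFi : F (X i) = h) (hFj : F (X j) = u) (r : ℕ) :
    F^[r] (X i) ≠ 0 := by
  by_cases hj : h ∈ supported R {j}ᶜ
  · have hi : h ∈ supported R {i} := by
      rw [mem_supported] at hh hj ⊢
      exact fun l hl => (hh hl).resolve_right (hj hl)
    obtain ⟨Q, rfl⟩ := exists_eq_aeval_of_mem_supported_singleton hi
    refine iterate_ne_zero_of_transcendental (transcendental_X R i) (Q := Q) (fun hQ => ?_) hFi r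
    rw [Polynomial.eq_C_of_natDegree_eq_zero hQ, Polynomial.aeval_C] at htr
    exact htr (isAlgebraic_algebraMap _)
  · exact iterate_ne_zero_of_triangular hij hu hui hh hj (Or.inr ⟨hFi, hFj⟩)
      (X_mem_supported.2 (by simp)) (X_ne_zero _) r

end CommRing

end LeadingForms

/-! ### Existence of eigenvectors -/

theorem exists_max_one_sup_eq_sq {ι : Type*} (s : Finset ι) (u v : ι → ℕ) :
    ∃ θ : ℝ≥0, 1 ≤ θ ∧ max 1 (s.sup fun x => u x * θ + v x) = θ ^ 2 := by
  set B : ℝ≥0 := 1 + ∑ x ∈ s, ((u x : ℝ≥0) + v x)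
  have one_le_B : 1 ≤ B := le_self_add
  have sup_le_sq : (s.sup fun x => u x * B + v x) ≤ B ^ 2 := Finset.sup_le fun x hx => by
    calc u x * B + v x ≤ u x * B + v x * B := by gcongr; exact le_mul_of_one_le_right' one_le_B
      _ = (u x + v x) * B := (add_mul _ _ _).symm
      _ ≤ B * B := by
          gcongr
          exact (Finset.single_le_sum (f := fun x => (u x : ℝ≥0) + v x) (fun _ _ => zero_le)
            hx).trans le_add_self
      _ = B ^ 2 := (sq B).symm
  have continuous_max_sup : Continuous fun θ : ℝ≥0 => max 1 (s.sup fun x => u x * θ + v x) :=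
    continuous_const.max (Continuous.finset_sup_apply fun _ _ => by fun_prop)
  obtain ⟨θ, hθ, hroot⟩ := isPreconnected_Icc.intermediate_value₂
    (Set.left_mem_Icc.2 one_le_B) (Set.right_mem_Icc.2 one_le_B)
    (continuous_pow 2).continuousOn continuous_max_sup.continuousOn
    (by simp) (max_le (one_le_pow₀ one_le_B) sup_le_sq)
  exact ⟨θ, hθ.1, hroot.symm⟩

theorem exists_nat_mul_add_of_max_one_sup_eq {ι : Type*} {s : Finset ι} {u v : ι → ℕ} {θ t : ℝ≥0}
    (h : max 1 (s.sup fun x => u x * θ + v x) = t) : ∃ i j : ℕ, t = i * θ + j := by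
  rcases s.eq_empty_or_nonempty with rfl | hs
  · exact ⟨0, 1, by simpa using h.symm⟩
  · obtain ⟨x, -, hx⟩ := Finset.exists_mem_eq_sup s hs fun x => (u x : ℝ≥0) * θ + v x
    rcases max_choice 1 (s.sup fun x => (u x : ℝ≥0) * θ + v x) with h1 | h1
    · exact ⟨0, 1, by simpa using h.symm.trans h1⟩
    · exact ⟨u x, v x, (h.symm.trans h1).trans hx⟩

namespace AffEnd

variable {k : Type*} [Field k] {n : ℕ} {f : AffEnd k n} {θ : ℝ≥0} {μ : Fin n → ℝ≥0}

theorem apply_ne_zero_of_isUnit (hf : IsUnit f) (i : Fin n) : f i ≠ 0 := by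
  obtain ⟨g, hg⟩ := hf.exists_right_inv
  intro h0
  refine X_ne_zero (R := k) i ?_
  rw [← one_apply, ← hg, mul_apply, h0, map_zero]

theorem isEigenvector_iff_of_isUnit (hf : IsUnit f) :
    f.IsEigenvector θ μ ↔ ∀ i, weightedTotalDegree μ (f i) = θ * μ i :=
  forall_congr' fun i => by
    rw [weightedTotalDegree_coe μ (f i) (apply_ne_zero_of_isUnit hf i), WithBot.coe_inj]

/-- The weight `μ` is perturbed to the positive weight `μ + ε ν`, for `ε` small. -/
theorem exists_pos_forall_mem_weightLE {ν : Fin n → ℝ≥0}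
    (hμ : ∀ i, weightedTotalDegree μ (f i) ≤ θ * μ i)
    (hν : ∀ i, μ i = 0 → 0 < ν i ∧ weightedTotalDegree ν (f i) ≤ θ * ν i) {δ : ℝ≥0} (hδ : 0 < δ) :
    ∃ ρ : Fin n → ℝ≥0, (∀ i, 0 < ρ i) ∧ ∀ i, f i ∈ weightLE k ρ ((θ + δ) * ρ i) := by
  have eventually_small : ∀ᶠ ε : ℝ≥0 in 𝓝[>] 0,
      ∀ i, 0 < μ i → ε * weightedTotalDegree ν (f i) < δ * μ i := by
    refine nhdsWithin_le_nhds (Filter.eventually_all.2 fun i => ?_)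
    by_cases hi : 0 < μ i
    · have tendsto_zero : Filter.Tendsto (fun ε : ℝ≥0 => ε * weightedTotalDegree ν (f i)) (𝓝 0)
          (𝓝 0) := by
        simpa using (Filter.tendsto_id (x := 𝓝 (0 : ℝ≥0))).mul_const (weightedTotalDegree ν (f i))
      filter_upwards [tendsto_zero.eventually_lt_const (mul_pos hδ hi)] with ε h _ using h
    · exact Filter.Eventually.of_forall fun ε h => absurd h hi
  obtain ⟨ε, hε, hε0 : 0 < ε⟩ := (eventually_small.and self_mem_nhdsWithin).exists
  refine ⟨μ + ε • ν, fun i => ?_, fun i => ?_⟩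
  · rcases eq_zero_or_pos (μ i) with hi | hi
    · exact add_pos_of_nonneg_of_pos zero_le (mul_pos hε0 (hν i hi).1)
    · exact add_pos_of_pos_of_nonneg hi zero_le
  · refine mem_weightLE_iff_weightedTotalDegree_le.2
      ((weightedTotalDegree_add_smul_le μ ν ε (f i)).trans ?_)
    simp only [Pi.add_apply, Pi.smul_apply, smul_eq_mul]
    rcases eq_zero_or_pos (μ i) with hi | hi
    · calc weightedTotalDegree μ (f i) + ε * weightedTotalDegree ν (f i)
          ≤ θ * μ i + ε * (θ * ν i) := by gcongr; exacts [hμ i, (hν i hi).2]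
        _ = θ * (μ i + ε * ν i) := by ring
        _ ≤ (θ + δ) * (μ i + ε * ν i) := by gcongr; exact le_self_add
    · calc weightedTotalDegree μ (f i) + ε * weightedTotalDegree ν (f i)
          ≤ θ * μ i + δ * μ i := add_le_add (hμ i) (hε i hi).le
        _ = (θ + δ) * μ i := (add_mul _ _ _).symm
        _ ≤ (θ + δ) * (μ i + ε * ν i) := by gcongr; exact le_self_add

theorem hasStableEigenvalue_of_isEigenvector [NeZero n] (hf : IsUnit f) (h1 : 1 ≤ θ)
    (hH : ∃ i j : ℕ, θ ^ 2 = i * θ + j) (hμ0 : μ ≠ 0) (hμ : f.IsEigenvector θ μ)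
    (ν : Fin n → ℝ≥0) (hν : ∀ i, μ i = 0 → 0 < ν i ∧ weightedTotalDegree ν (f i) ≤ θ * ν i)
    (hS : 1 < θ → ∀ μ : Fin n → ℝ≥0, μ ≠ 0 → f.IsEigenvector θ μ → LeadingNonvanishing μ θ f) :
    f.HasStableEigenvalue θ := by
  obtain ⟨i, j, hij⟩ := hH
  refine hasStableEigenvalue_of_leadingNonvanishing hf h1 hij (fun δ hδ => ?_) ⟨μ, hμ0, hμ⟩ hS
  exact exists_pos_forall_mem_weightLE
    (fun i => ((isEigenvector_iff_of_isUnit hf).1 hμ i).le) hν hδ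

end AffEnd

/-! ### Automorphisms of affine three-space -/

namespace AffEnd

variable {k : Type*} [Field k] {a b c e : k} {p : Polynomial k} {q : MvPolynomial (Fin 3) k}
  {μ : Fin 3 → ℝ≥0} {θ w : ℝ≥0}

/-- The first component of a triangular automorphism of affine three-space. -/
def triFst (a b : k) : MvPolynomial (Fin 3) k :=
  C a * X 0 + C b

/-- The second component of a triangular automorphism of affine three-space. -/
def triSnd (c : k) (p : Polynomial k) : MvPolynomial (Fin 3) k :=
  C c * X 1 + Polynomial.aeval (X 0) p

/-- The third component of a triangular automorphism of affine three-space; there `q` is a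
polynomial in the first two variables. -/
def triThd (e : k) (q : MvPolynomial (Fin 3) k) : MvPolynomial (Fin 3) k :=
  C e * X 2 + q

theorem triFst_mem_supported (a b : k) : triFst a b ∈ supported k {0} :=
  add_mem (C_mul_mem_supported _ (X_mem_supported.2 rfl)) (C_mem_supported _ _)

theorem triSnd_mem_supported (c : k) (p : Polynomial k) : triSnd c p ∈ supported k {0, 1} :=
  add_mem (C_mul_mem_supported _ (X_mem_supported.2 (by simp)))
    (supported_mono (by simp) (aeval_X_mem_supported 0 p))

theorem triFst_notMem_supported (ha : a ≠ 0) (b : k) : triFst a b ∉ supported k {0}ᶜ :=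
  C_mul_X_add_notMem_supported ha (C_mem_supported _ _)

theorem mem_supported_compl_two (hq : q ∈ supported k {0, 1}) : q ∈ supported k {2}ᶜ :=
  supported_mono (by simp) hq

theorem aeval_X_zero_mem_supported_compl_one (p : Polynomial k) :
    Polynomial.aeval (X 0 : MvPolynomial (Fin 3) k) p ∈ supported k {1}ᶜ :=
  supported_mono (by simp) (aeval_X_mem_supported 0 p)

theorem IsTriangular.exists_normal_form {t : AffEnd k 3} (ht : t.IsTriangular) (hu : IsUnit t) :
    ∃ (a b c e : k) (p : Polynomial k) (q : MvPolynomial (Fin 3) k), a ≠ 0 ∧ c ≠ 0 ∧ e ≠ 0 ∧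
      q ∈ supported k {0, 1} ∧ t = ofFun ![triFst a b, triSnd c p, triThd e q] := by
  obtain ⟨a, ha, q₀, hq₀, h0⟩ := ht.exists_eq_C_mul_X_add hu 0
  obtain ⟨c, hc, q₁, hq₁, h1⟩ := ht.exists_eq_C_mul_X_add hu 1
  obtain ⟨e, he, q₂, hq₂, h2⟩ := ht.exists_eq_C_mul_X_add hu 2
  rw [show Set.Iio (0 : Fin 3) = ∅ by ext i; fin_cases i <;> simp, supported_empty] at hq₀
  rw [show Set.Iio (1 : Fin 3) = {0} by ext i; fin_cases i <;> simp] at hq₁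
  rw [show Set.Iio (2 : Fin 3) = {0, 1} by ext i; fin_cases i <;> simp [Fin.lt_def]] at hq₂
  obtain ⟨b, rfl⟩ := Algebra.mem_bot.1 hq₀
  obtain ⟨p, rfl⟩ := exists_eq_aeval_of_mem_supported_singleton hq₁
  refine ⟨a, b, c, e, p, q₂, ha, hc, he, hq₂, funext fun i => ?_⟩
  fin_cases i
  exacts [h0, h1, h2]

theorem forall_fin_three {P : Fin 3 → Prop} : (∀ i, P i) ↔ P 0 ∧ P 1 ∧ P 2 := by
  rw [Fin.forall_fin_succ, Fin.forall_fin_two]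
  rfl

theorem weightedTotalDegree_triFst (ha : a ≠ 0) : weightedTotalDegree μ (triFst a b) = μ 0 := by
  rw [triFst, weightedTotalDegree_C_mul_X_add ha (C_mem_supported _ _), max_eq_left]
  exact mem_weightLE_iff_weightedTotalDegree_le.1 (weightLE_mono zero_le (C_mem_weightLE b))

theorem weightedTotalDegree_triSnd (hc : c ≠ 0) :
    weightedTotalDegree μ (triSnd c p) = max (μ 1) (p.natDegree * μ 0) := by
  rw [triSnd, weightedTotalDegree_C_mul_X_add hc (aeval_X_zero_mem_supported_compl_one p),
    weightedTotalDegree_aeval_X]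

theorem weightedTotalDegree_triThd (he : e ≠ 0) (hq : q ∈ supported k {0, 1}) :
    weightedTotalDegree μ (triThd e q) = max (μ 2) (weightedTotalDegree μ q) :=
  weightedTotalDegree_C_mul_X_add he (mem_supported_compl_two hq)

theorem weightedTotalDegree_eq_sup (hq : q ∈ supported k {0, 1}) :
    weightedTotalDegree μ q = q.support.sup fun m => m 0 * μ 0 + m 1 * μ 1 := by
  refine Finset.sup_congr rfl fun m hm => ?_
  have apply_two : m 2 = 0 :=
    mem_supported_iff_forall_support.1 (mem_supported_compl_two hq) m hm 2 (by simp)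
  simp [Finsupp.weight_apply, Finsupp.sum_fintype, Fin.sum_univ_three, apply_two]

theorem isEigenvector_vec_iff {P Q R : MvPolynomial (Fin 3) k} (hf : IsUnit (ofFun ![P, Q, R])) :
    (ofFun ![P, Q, R]).IsEigenvector θ μ ↔ weightedTotalDegree μ P = θ * μ 0 ∧
      weightedTotalDegree μ Q = θ * μ 1 ∧ weightedTotalDegree μ R = θ * μ 2 := by
  simp [isEigenvector_iff_of_isUnit hf, Fin.forall_fin_succ]

theorem weightedHomogeneousComponent_triFst (hw : w ≠ 0) :
    weightedHomogeneousComponent μ w (triFst a b) = if μ 0 = w then C a * X 0 else 0 := by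
  rw [triFst, map_add, weightedHomogeneousComponent_C_mul_X,
    (isWeightedHomogeneous_C μ b).weightedHomogeneousComponent_ne w hw, add_zero]

theorem weightedHomogeneousComponent_triSnd (h0 : 0 < μ 0) (hw : p.natDegree * μ 0 = w) :
    weightedHomogeneousComponent μ w (triSnd c p) =
      (if μ 1 = w then C c * X 1 else 0) + C p.leadingCoeff * X 0 ^ p.natDegree := by
  rw [triSnd, map_add, weightedHomogeneousComponent_C_mul_X, ← hw,
    (isLeadingForm_aeval_X h0 p).weightedHomogeneousComponent_eq]

theorem weightedHomogeneousComponent_triThd (hw : μ 2 ≠ w) :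
    weightedHomogeneousComponent μ w (triThd e q) = weightedHomogeneousComponent μ w q := by
  rw [triThd, map_add, weightedHomogeneousComponent_C_mul_X, if_neg hw, zero_add]

theorem eq_of_max_eq_of_ne {x y : ℝ≥0} (h : max x y = w) (hx : x ≠ w) : y = w :=
  ((max_choice x y).resolve_left fun hm => hx (hm.symm.trans h)).symm.trans h

theorem weightedTotalDegree_eq_of_triThd (he : e ≠ 0) (hq : q ∈ supported k {0, 1})
    (h : weightedTotalDegree μ (triThd e q) = w) (hw : μ 2 ≠ w) : weightedTotalDegree μ q = w :=
  eq_of_max_eq_of_ne ((weightedTotalDegree_triThd he hq).symm.trans h) hw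

theorem leadingNonvanishing_of_iterate {n : ℕ} {f : AffEnd k n} {μ : Fin n → ℝ≥0} {i : Fin n}
    (hi : 0 < μ i) (h : ∀ r, (leadingPart μ θ f).subst^[r] (X i) ≠ 0) :
    LeadingNonvanishing μ θ f :=
  ⟨i, hi, fun r => by rw [pow_apply_eq_iterate]; exact h r⟩

theorem subst_leadingPart_X {n : ℕ} (μ : Fin n → ℝ≥0) (θ : ℝ≥0) (f : AffEnd k n) (i : Fin n) :
    (leadingPart μ θ f).subst (X i) = weightedHomogeneousComponent μ (θ * μ i) (f i) :=
  subst_X _ i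

theorem eq_zero_of_eq_mul_of_one_lt {x : ℝ≥0} (hθ : 1 < θ) (h : x = θ * x) : x = 0 := by
  by_contra hx
  exact (lt_mul_of_one_lt_left (pos_of_ne_zero hx) hθ).ne h

theorem leadingNonvanishing_of_apply_zero {f : AffEnd k 3} (hf : f 0 = triSnd c p) (hθ : 0 < θ)
    (h0 : 0 < μ 0) (hE : max (μ 1) (p.natDegree * μ 0) = θ * μ 0) (hne : μ 1 ≠ θ * μ 0) :
    LeadingNonvanishing μ θ f := by
  have hd : p.natDegree * μ 0 = θ * μ 0 := eq_of_max_eq_of_ne hE hne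
  have hd0 : p.natDegree ≠ 0 := by
    rintro h
    rw [h, Nat.cast_zero, zero_mul] at hd
    exact (mul_pos hθ h0).ne hd
  have hp : p.leadingCoeff ≠ 0 :=
    Polynomial.leadingCoeff_ne_zero.2 fun h => hd0 (by rw [h, Polynomial.natDegree_zero])
  refine leadingNonvanishing_of_iterate h0 (iterate_ne_zero_of_transcendental
    (transcendental_X k 0) (Q := Polynomial.C p.leadingCoeff * Polynomial.X ^ p.natDegree) ?_ ?_)
  · rwa [Polynomial.natDegree_C_mul_X_pow _ _ hp]
  · rw [subst_leadingPart_X, hf, weightedHomogeneousComponent_triSnd h0 hd, if_neg hne, zero_add]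
    simp

theorem leadingNonvanishing_of_apply_eq_triThd_of_weight_eq_zero {f : AffEnd k 3} {i j : Fin 3}
    (hij : i ≠ j) (hs : ({0, 1} : Set (Fin 3)) = {i, j}) (hfi : f i ∈ supported k {i})
    (hfi' : f i ∉ supported k {i}ᶜ) (hfj : f j = triThd e q) (he : e ≠ 0)
    (hq : q ∈ supported k {0, 1}) (hμi : μ i = 0) (hi : weightedTotalDegree μ (f i) = 0)
    (hθ : 0 < θ) (hμj : 0 < μ j) (hj : weightedTotalDegree μ (triThd e q) = θ * μ j)
    (hne : μ 2 ≠ θ * μ j) : LeadingNonvanishing μ θ f := by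
  have hw : θ * μ j ≠ 0 := (mul_pos hθ hμj).ne'
  have hqs : weightedHomogeneousComponent μ (θ * μ j) q ∈ supported k {i, j} :=
    weightedHomogeneousComponent_mem_supported (hs ▸ hq)
  refine leadingNonvanishing_of_iterate hμj (iterate_ne_zero_of_triangular hij hfi hfi' hqs ?_
    (Or.inl ⟨?_, ?_⟩) (X_mem_supported.2 (by simp)) (X_ne_zero j))
  · refine notMem_supported_of_isWeightedHomogeneous
      (weightedHomogeneousComponent_isWeightedHomogeneous _ _)
      (weightedHomogeneousComponent_ne_zero (weightedTotalDegree_eq_of_triThd he hq hj hne) hw)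
      hw hqs ?_
    rintro l (rfl | rfl) hl
    exacts [hμi, absurd rfl hl]
  · rw [subst_leadingPart_X, hμi, mul_zero, weightedHomogeneousComponent_zero_eq_self hi]
  · rw [subst_leadingPart_X, hfj, weightedHomogeneousComponent_triThd hne]

theorem leadingNonvanishing_of_apply_zero_eq_triThd {f : AffEnd k 3} {u : MvPolynomial (Fin 3) k}
    (hf0 : f 0 = triThd e q) (he : e ≠ 0) (hq : q ∈ supported k {0, 1})
    (hu : weightedHomogeneousComponent μ (θ * μ 1) (f 1) = u) (hus : u ∈ supported k {0})
    (hu0 : u ≠ 0) (hθ : 0 < θ) (hμ0 : 0 < μ 0) (hμ1 : 0 < μ 1)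
    (h0 : weightedTotalDegree μ (triThd e q) = θ * μ 0) (hne : μ 2 ≠ θ * μ 0) :
    LeadingNonvanishing μ θ f := by
  have hw : θ * μ 0 ≠ 0 := (mul_pos hθ hμ0).ne'
  refine leadingNonvanishing_of_iterate hμ0 (iterate_X_ne_zero_of_transcendental zero_ne_one
    (weightedHomogeneousComponent_mem_supported hq) (transcendental_of_isWeightedHomogeneous
      (weightedHomogeneousComponent_isWeightedHomogeneous _ _)
      (weightedHomogeneousComponent_ne_zero (weightedTotalDegree_eq_of_triThd he hq h0 hne) hw) hw)
    hus ?_ ?_ ((subst_leadingPart_X _ _ _ _).trans hu))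
  · exact notMem_supported_of_isWeightedHomogeneous
      (hu ▸ weightedHomogeneousComponent_isWeightedHomogeneous _ _) hu0 (mul_pos hθ hμ1).ne' hus
      fun i hi hi' => absurd hi hi'
  · rw [subst_leadingPart_X, hf0, weightedHomogeneousComponent_triThd hne]

theorem leadingNonvanishing_swap01 (ha : a ≠ 0) (hc : c ≠ 0) (he : e ≠ 0)
    (hq : q ∈ supported k {0, 1}) (hu : IsUnit (ofFun ![triSnd c p, triFst a b, triThd e q]))
    (h1 : 1 < θ) (hμ : μ ≠ 0)
    (hE : (ofFun ![triSnd c p, triFst a b, triThd e q]).IsEigenvector θ μ) :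
    LeadingNonvanishing μ θ (ofFun ![triSnd c p, triFst a b, triThd e q]) := by
  obtain ⟨h₀, h₁, h₂⟩ := (isEigenvector_vec_iff hu).1 hE
  rw [weightedTotalDegree_triSnd hc] at h₀
  rw [weightedTotalDegree_triFst ha] at h₁
  have hθ : 0 < θ := zero_lt_one.trans h1
  have hμ1 : 0 < μ 1 := by
    refine pos_of_ne_zero fun h1' => hμ ?_
    have hμ0 : μ 0 = 0 := by rw [h₁, h1', mul_zero]
    have hμ2 : μ 2 = 0 := by
      rw [weightedTotalDegree_triThd he hq, weightedTotalDegree_eq_sup hq] at h₂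
      exact eq_zero_of_eq_mul_of_one_lt h1 (by simpa [hμ0, h1'] using h₂)
    exact funext (forall_fin_three.2 ⟨hμ0, h1', hμ2⟩)
  have hμ0 : 0 < μ 0 := h₁ ▸ mul_pos hθ hμ1
  refine leadingNonvanishing_of_apply_zero rfl hθ hμ0 h₀ (ne_of_lt ?_)
  calc μ 1 < θ * μ 1 := lt_mul_of_one_lt_left hμ1 h1
    _ = μ 0 := h₁.symm
    _ < θ * μ 0 := lt_mul_of_one_lt_left hμ0 h1

theorem leadingNonvanishing_swap12 (ha : a ≠ 0) (hc : c ≠ 0) (he : e ≠ 0)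
    (hq : q ∈ supported k {0, 1}) (hu : IsUnit (ofFun ![triFst a b, triThd e q, triSnd c p]))
    (h1 : 1 < θ) (hμ : μ ≠ 0)
    (hE : (ofFun ![triFst a b, triThd e q, triSnd c p]).IsEigenvector θ μ) :
    LeadingNonvanishing μ θ (ofFun ![triFst a b, triThd e q, triSnd c p]) := by
  obtain ⟨h₀, h₁, h₂⟩ := (isEigenvector_vec_iff hu).1 hE
  rw [weightedTotalDegree_triFst ha] at h₀
  have hθ : 0 < θ := zero_lt_one.trans h1
  have hμ0 : μ 0 = 0 := eq_zero_of_eq_mul_of_one_lt h1 h₀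
  replace h₂ : μ 1 = θ * μ 2 := by simpa [weightedTotalDegree_triSnd hc, hμ0] using h₂
  have hμ2 : 0 < μ 2 := by
    refine pos_of_ne_zero fun h2 => hμ (funext (forall_fin_three.2 ⟨hμ0, ?_, h2⟩))
    rw [h₂, h2, mul_zero]
    rfl
  have hμ1 : 0 < μ 1 := h₂ ▸ mul_pos hθ hμ2
  refine leadingNonvanishing_of_apply_eq_triThd_of_weight_eq_zero zero_ne_one rfl
    (triFst_mem_supported a b) (triFst_notMem_supported ha b) rfl he hq hμ0
    ((weightedTotalDegree_triFst ha).trans hμ0) hθ hμ1 h₁ (ne_of_lt ?_)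
  calc μ 2 < θ * μ 2 := lt_mul_of_one_lt_left hμ2 h1
    _ = μ 1 := h₂.symm
    _ < θ * μ 1 := lt_mul_of_one_lt_left hμ1 h1

theorem leadingNonvanishing_swap02 (ha : a ≠ 0) (hc : c ≠ 0) (he : e ≠ 0)
    (hq : q ∈ supported k {0, 1}) (hu : IsUnit (ofFun ![triThd e q, triSnd c p, triFst a b]))
    (h1 : 1 < θ) (hμ : μ ≠ 0)
    (hE : (ofFun ![triThd e q, triSnd c p, triFst a b]).IsEigenvector θ μ) :
    LeadingNonvanishing μ θ (ofFun ![triThd e q, triSnd c p, triFst a b]) := by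
  obtain ⟨h₀, h₁, h₂⟩ := (isEigenvector_vec_iff hu).1 hE
  rw [weightedTotalDegree_triSnd hc] at h₁
  rw [weightedTotalDegree_triFst ha] at h₂
  have hθ : 0 < θ := zero_lt_one.trans h1
  have hμ2 : 0 < μ 2 := by
    refine pos_of_ne_zero fun h2 => hμ ?_
    have hμ0 : μ 0 = 0 := by rw [h₂, h2, mul_zero]
    have hμ1 : μ 1 = 0 := eq_zero_of_eq_mul_of_one_lt h1 (by simpa [hμ0] using h₁)
    exact funext (forall_fin_three.2 ⟨hμ0, hμ1, h2⟩)
  have hμ0 : 0 < μ 0 := h₂ ▸ mul_pos hθ hμ2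
  have hne : μ 2 ≠ θ * μ 0 := ne_of_lt <|
    calc μ 2 < θ * μ 2 := lt_mul_of_one_lt_left hμ2 h1
      _ = μ 0 := h₂.symm
      _ < θ * μ 0 := lt_mul_of_one_lt_left hμ0 h1
  rcases eq_or_ne p.natDegree 0 with hd | hd
  · have hμ1 : μ 1 = 0 := eq_zero_of_eq_mul_of_one_lt h1 (by simpa [hd] using h₁)
    obtain ⟨p₀, rfl⟩ : ∃ p₀, p = Polynomial.C p₀ := ⟨_, Polynomial.eq_C_of_natDegree_eq_zero hd⟩
    have triSnd_eq : triSnd c (Polynomial.C p₀) = C c * X 1 + C p₀ := by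
      rw [triSnd, Polynomial.aeval_C]
      rfl
    refine leadingNonvanishing_of_apply_eq_triThd_of_weight_eq_zero one_ne_zero
      (Set.pair_comm 0 1) ?_ ?_ rfl he hq hμ1 ?_ hθ hμ0 h₀ hne
    · exact triSnd_eq ▸ add_mem (C_mul_mem_supported _ (X_mem_supported.2 rfl))
        (C_mem_supported _ _)
    · exact triSnd_eq ▸ C_mul_X_add_notMem_supported hc (C_mem_supported _ _)
    · simp [weightedTotalDegree_triSnd hc, hμ1]
  · have hμ1 : 0 < μ 1 := by
      refine pos_of_ne_zero fun h => ?_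
      simp [h, hd, hμ0.ne'] at h₁
    have hne1 : μ 1 ≠ θ * μ 1 := (lt_mul_of_one_lt_left hμ1 h1).ne
    have hp : p.leadingCoeff ≠ 0 :=
      Polynomial.leadingCoeff_ne_zero.2 fun h => hd (by rw [h, Polynomial.natDegree_zero])
    have component_eq := weightedHomogeneousComponent_triSnd (c := c) hμ0
      (eq_of_max_eq_of_ne h₁ hne1)
    rw [if_neg hne1, zero_add] at component_eq
    have leadingTerm_mem : (C p.leadingCoeff * X 0 ^ p.natDegree : MvPolynomial (Fin 3) k) ∈
        supported k {0} :=
      C_mul_mem_supported _ (Subalgebra.pow_mem _ (X_mem_supported.2 (Set.mem_singleton 0)) _)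
    exact leadingNonvanishing_of_apply_zero_eq_triThd rfl he hq component_eq leadingTerm_mem
      (mul_ne_zero (C_ne_zero.2 hp) (pow_ne_zero _ (X_ne_zero 0))) hθ hμ0 hμ1 h₀ hne

theorem leadingNonvanishing_cycle201 (ha : a ≠ 0) (hc : c ≠ 0) (he : e ≠ 0)
    (hq : q ∈ supported k {0, 1}) (hu : IsUnit (ofFun ![triThd e q, triFst a b, triSnd c 0]))
    (h1 : 1 < θ) (hμ : μ ≠ 0)
    (hE : (ofFun ![triThd e q, triFst a b, triSnd c 0]).IsEigenvector θ μ) :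
    LeadingNonvanishing μ θ (ofFun ![triThd e q, triFst a b, triSnd c 0]) := by
  obtain ⟨h₀, h₁, h₂⟩ := (isEigenvector_vec_iff hu).1 hE
  rw [weightedTotalDegree_triFst ha] at h₁
  replace h₂ : μ 1 = θ * μ 2 := by simpa [weightedTotalDegree_triSnd hc] using h₂
  have hθ : 0 < θ := zero_lt_one.trans h1
  have hμ2 : 0 < μ 2 := by
    refine pos_of_ne_zero fun h2 => hμ ?_
    have hμ1 : μ 1 = 0 := by rw [h₂, h2, mul_zero]
    have hμ0 : μ 0 = 0 := by rw [h₁, hμ1, mul_zero]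
    exact funext (forall_fin_three.2 ⟨hμ0, hμ1, h2⟩)
  have hμ1 : 0 < μ 1 := h₂ ▸ mul_pos hθ hμ2
  have hμ0 : 0 < μ 0 := h₁ ▸ mul_pos hθ hμ1
  refine leadingNonvanishing_of_apply_zero_eq_triThd (u := C a * X 0) rfl he hq ?_
    (C_mul_mem_supported _ (X_mem_supported.2 rfl))
    (mul_ne_zero (C_ne_zero.2 ha) (X_ne_zero 0)) hθ hμ0 hμ1 h₀ (ne_of_lt ?_)
  · rw [ofFun_apply]
    exact (weightedHomogeneousComponent_triFst (mul_pos hθ hμ1).ne').trans (if_pos h₁)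
  · calc μ 2 < θ * μ 2 := lt_mul_of_one_lt_left hμ2 h1
      _ = μ 1 := h₂.symm
      _ < θ * μ 1 := lt_mul_of_one_lt_left hμ1 h1
      _ = μ 0 := h₁.symm
      _ < θ * μ 0 := lt_mul_of_one_lt_left hμ0 h1

theorem hasStableEigenvalue_id (ha : a ≠ 0) (hc : c ≠ 0) (he : e ≠ 0)
    (hq : q ∈ supported k {0, 1}) (hu : IsUnit (ofFun ![triFst a b, triSnd c p, triThd e q])) :
    HasStableEigenvalue (ofFun ![triFst a b, triSnd c p, triThd e q]) 1 := by
  refine hasStableEigenvalue_of_isEigenvector (μ := ![0, 0, 1]) hu le_rfl ⟨0, 1, by simp⟩ (by simp)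
    ((isEigenvector_vec_iff hu).2 ?_) ![1, p.natDegree + 1, 1] ?_ fun h => absurd h (lt_irrefl 1)
  · simp [weightedTotalDegree_triFst ha, weightedTotalDegree_triSnd hc,
      weightedTotalDegree_triThd he hq, weightedTotalDegree_eq_sup hq]
  · simp [Fin.forall_fin_succ, weightedTotalDegree_triFst ha, weightedTotalDegree_triSnd hc]

theorem exists_hasStableEigenvalue_swap01 (ha : a ≠ 0) (hc : c ≠ 0) (he : e ≠ 0)
    (hq : q ∈ supported k {0, 1}) (hu : IsUnit (ofFun ![triSnd c p, triFst a b, triThd e q])) :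
    ∃ θ, HasStableEigenvalue (ofFun ![triSnd c p, triFst a b, triThd e q]) θ := by
  set θ : ℝ≥0 := max 1 p.natDegree with hθ
  set W : ℝ≥0 := q.support.sup fun m => m 0 * θ + m 1 with hW
  have h1 : 1 ≤ θ := le_max_left _ _
  have max_natDegree_mul : max 1 (p.natDegree * θ) = θ * θ := by
    rcases p.natDegree.eq_zero_or_pos with hd | hd
    · simp [hθ, hd]
    · have hdθ : θ = p.natDegree := max_eq_right (mod_cast hd)
      rw [← hdθ, max_eq_right (one_le_mul h1 h1)]
  have max_div : max (W / θ) W = θ * (W / θ) := by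
    rw [max_eq_right (div_le_self zero_le h1), mul_div_cancel₀ _ (zero_lt_one.trans_le h1).ne']
  refine ⟨θ, hasStableEigenvalue_of_isEigenvector (μ := ![θ, 1, W / θ]) hu h1
    ⟨max 1 p.natDegree, 0, by push_cast; rw [← hθ, sq, add_zero]⟩ (fun h => ?_)
    ((isEigenvector_vec_iff hu).2 ?_) ![0, 0, 1] ?_
    fun h1 μ hμ => leadingNonvanishing_swap01 ha hc he hq hu h1 hμ⟩
  · simpa using congrFun h 1
  · simpa [weightedTotalDegree_triFst ha, weightedTotalDegree_triSnd hc,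
      weightedTotalDegree_triThd he hq, weightedTotalDegree_eq_sup hq, ← hW]
      using ⟨max_natDegree_mul, max_div⟩
  · simp [Fin.forall_fin_succ, weightedTotalDegree_triThd he hq, weightedTotalDegree_eq_sup hq,
      (zero_lt_one.trans_le h1).ne', h1]

theorem exists_hasStableEigenvalue_swap12 (ha : a ≠ 0) (hc : c ≠ 0) (he : e ≠ 0)
    (hq : q ∈ supported k {0, 1}) (hu : IsUnit (ofFun ![triFst a b, triThd e q, triSnd c p])) :
    ∃ θ, HasStableEigenvalue (ofFun ![triFst a b, triThd e q, triSnd c p]) θ := by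
  obtain ⟨θ, h1, hθ⟩ := exists_max_one_sup_eq_sq q.support (fun m => m 1) fun _ => 0
  refine ⟨θ, hasStableEigenvalue_of_isEigenvector (μ := ![0, θ, 1]) hu h1
    (exists_nat_mul_add_of_max_one_sup_eq hθ) (fun h => ?_)
    ((isEigenvector_vec_iff hu).2 ?_) ![1, 0, 0] ?_
    fun h1 μ hμ => leadingNonvanishing_swap12 ha hc he hq hu h1 hμ⟩
  · simpa using congrFun h 2
  · simpa [weightedTotalDegree_triFst ha, weightedTotalDegree_triSnd hc,
      weightedTotalDegree_triThd he hq, weightedTotalDegree_eq_sup hq, sq] using hθ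
  · simp [Fin.forall_fin_succ, weightedTotalDegree_triFst ha, (zero_lt_one.trans_le h1).ne', h1]

theorem exists_hasStableEigenvalue_swap02 (ha : a ≠ 0) (hc : c ≠ 0) (he : e ≠ 0)
    (hq : q ∈ supported k {0, 1}) (hu : IsUnit (ofFun ![triThd e q, triSnd c p, triFst a b])) :
    ∃ θ, HasStableEigenvalue (ofFun ![triThd e q, triSnd c p, triFst a b]) θ := by
  obtain ⟨θ, h1, hθ⟩ := exists_max_one_sup_eq_sq q.support (fun m => m 0)
    fun m => m 1 * p.natDegree
  have max_natDegree : max (p.natDegree : ℝ≥0) (p.natDegree * θ) = θ * p.natDegree := by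
    rw [mul_comm, max_eq_right (le_mul_of_one_le_left zero_le h1)]
  refine ⟨θ, hasStableEigenvalue_of_isEigenvector (μ := ![θ, p.natDegree, 1]) hu h1
    (exists_nat_mul_add_of_max_one_sup_eq hθ) (fun h => ?_)
    ((isEigenvector_vec_iff hu).2 ?_) ![0, 1, 0] ?_
    fun h1 μ hμ => leadingNonvanishing_swap02 ha hc he hq hu h1 hμ⟩
  · simpa using congrFun h 2
  · push_cast at hθ
    simpa [weightedTotalDegree_triFst ha, weightedTotalDegree_triSnd hc,
      weightedTotalDegree_triThd he hq, weightedTotalDegree_eq_sup hq, sq]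
      using ⟨hθ.trans (sq θ), max_natDegree⟩
  · simp [Fin.forall_fin_succ, weightedTotalDegree_triSnd hc, (zero_lt_one.trans_le h1).ne', h1]

theorem exists_hasStableEigenvalue_cycle201 (ha : a ≠ 0) (hc : c ≠ 0) (he : e ≠ 0)
    (hq : q ∈ supported k {0, 1}) (hu : IsUnit (ofFun ![triThd e q, triFst a b, triSnd c 0])) :
    ∃ θ, HasStableEigenvalue (ofFun ![triThd e q, triFst a b, triSnd c 0]) θ := by
  obtain ⟨θ, h1, hθ⟩ := exists_max_one_sup_eq_sq q.support (fun m => m 0) fun m => m 1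
  have hθ0 : θ ≠ 0 := (zero_lt_one.trans_le h1).ne'
  have max_inv : max θ⁻¹ (q.support.sup fun m => m 0 * θ + m 1) = θ * θ := by
    rcases max_choice 1 (q.support.sup fun m => (m 0 : ℝ≥0) * θ + m 1) with hm | hm
    · obtain rfl : θ = 1 := by simpa [hm] using hθ.symm
      simpa using hθ
    · rw [← sq, ← hθ, hm, max_eq_right]
      rw [← hm, hθ]
      exact (inv_le_one_of_one_le₀ h1).trans (one_le_pow₀ h1)
  refine ⟨θ, hasStableEigenvalue_of_isEigenvector (μ := ![θ, 1, θ⁻¹]) hu h1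
    (exists_nat_mul_add_of_max_one_sup_eq hθ) (fun h => ?_)
    ((isEigenvector_vec_iff hu).2 ⟨?_, ?_, ?_⟩) 0 ?_
    fun h1 μ hμ => leadingNonvanishing_cycle201 ha hc he hq hu h1 hμ⟩
  · simpa using congrFun h 1
  · simpa [weightedTotalDegree_triThd he hq, weightedTotalDegree_eq_sup hq] using max_inv
  · simp [weightedTotalDegree_triFst ha]
  · simp [weightedTotalDegree_triSnd hc, hθ0]
  · simp [Fin.forall_fin_succ, hθ0]

end AffEnd

namespace AffEnd

variable {k : Type*} [Field k] {n : ℕ}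

/-- Some member of the conjugacy class of `f`, of degree at most that of `f`, is
permutation-triangular and has a stable maximal eigenvalue. -/
def HasStableModel (f : AffEnd k n) : Prop :=
  ∃ f' : AffEnd k n, f'.IsPermTriangular ∧ IsConj f f' ∧ f'.degree ≤ f.degree ∧
    ∃ θ, HasStableEigenvalue f' θ

theorem HasStableModel.of_isConj {f g : AffEnd k n} (hg : HasStableModel g) (hc : IsConj f g)
    (hd : g.degree ≤ f.degree) : HasStableModel f := by
  obtain ⟨f', hp, hgf', hle, hθ⟩ := hg
  exact ⟨f', hp, hc.trans hgf', hle.trans hd, hθ⟩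

theorem isConj_of_isUnit {f g φ : AffEnd k n} (hφ : IsUnit φ) (h : φ * f = g * φ) :
    IsConj f g := by
  obtain ⟨u, rfl⟩ := hφ
  exact ⟨u, h⟩

/-- If `F(Xⱼ)` is not a polynomial in `u = F(Xᵢ)`, then, in the coordinates `u`, `Xᵢ`, the
restriction of `F` to `k[Xᵢ, Xⱼ]` is triangular with algebraically independent components. -/
theorem exists_eq_aeval_or_iterate_X_ne_zero {i j : Fin n} (hij : i ≠ j) {c : k} (hc : c ≠ 0)
    {r : MvPolynomial (Fin n) k} (hr : r ∈ supported k {i})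
    {F : MvPolynomial (Fin n) k →ₐ[k] MvPolynomial (Fin n) k} (hFi : F (X i) = C c * X j + r)
    (hFj : F (X j) ∈ supported k {i, j}) :
    (∃ Q : Polynomial k, F (X j) = Polynomial.aeval (F (X i)) Q) ∨ ∀ m, F^[m] (X i) ≠ 0 := by
  have hrj : r ∈ supported k {j}ᶜ := supported_mono (by simpa using hij.symm) hr
  set U : AffEnd k n := elementary j c r with hU
  set V : AffEnd k n := elementary j c⁻¹ (-(C c⁻¹ * r)) with hV
  have subst_U_V P : U.subst (V.subst P) = P := by
    rw [← subst_mul, hV, hU, elementary_mul_elementary' (mul_inv_cancel₀ hc) hrj, subst_one]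
  have subst_V_U P : V.subst (U.subst P) = P := by
    rw [← subst_mul, hV, hU, elementary_mul_elementary (mul_inv_cancel₀ hc) hrj, subst_one]
  have subst_U_X : U.subst (X j) = F (X i) := by rw [subst_X, hU, elementary_self, hFi]
  have V_mem : ∀ l ∈ ({i, j} : Set (Fin n)), V l ∈ supported k {i, j} := by
    rintro l (rfl | rfl)
    · rw [hV, elementary_of_ne hij]
      exact X_mem_supported.2 (by simp)
    · rw [hV, elementary_self]
      exact add_mem (C_mul_mem_supported _ (X_mem_supported.2 (by simp)))
        (neg_mem (C_mul_mem_supported _ (supported_mono (by simp) hr)))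
  have subst_V_mem : V.subst (F (X j)) ∈ supported k {i, j} := subst_mem_supported V_mem hFj
  by_cases hi : V.subst (F (X j)) ∈ supported k {i}ᶜ
  · have hj : V.subst (F (X j)) ∈ supported k {j} := by
      rw [mem_supported] at subst_V_mem hi ⊢
      exact fun l hl => (subst_V_mem hl).resolve_left (hi hl)
    obtain ⟨Q, hQ⟩ := exists_eq_aeval_of_mem_supported_singleton hj
    refine Or.inl ⟨Q, ?_⟩
    rw [← subst_U_V (F (X j)), hQ, ← Polynomial.aeval_algHom_apply, subst_U_X]
  · refine Or.inr (iterate_ne_zero_of_algebraicIndepOn (s := {i, j}) ?_ ?_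
      (X_mem_supported.2 (by simp)) (X_ne_zero i))
    · rintro l (rfl | rfl)
      · exact hFi ▸ add_mem (C_mul_mem_supported _ (X_mem_supported.2 (by simp)))
          (supported_mono (by simp) hr)
      · exact hFj
    · have subst_V_F : V.subst (F (X i)) = X j := by rw [← subst_U_X, subst_V_U]
      refine AlgebraicIndependent.of_comp V.subst
        (algebraicIndepOn_pair (x := fun l => V.subst (F (X l))) hij.symm ?_ ?_ hi)
      · exact subst_V_F ▸ X_mem_supported.2 rfl
      · exact subst_V_F ▸ fun h => by simpa using X_mem_supported.1 h

theorem iterate_X_ne_zero_or_exists_eq_C {i j : Fin n} (hij : i ≠ j) {c : k} (hc : c ≠ 0)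
    {s : Polynomial k} {F : MvPolynomial (Fin n) k →ₐ[k] MvPolynomial (Fin n) k}
    (hFi : F (X i) = C c * X j + Polynomial.aeval (X i) s) (hFj : F (X j) ∈ supported k {i, j}) :
    (∀ m, F^[m] (X i) ≠ 0) ∨ ∃ κ, F (F (X i)) = C κ := by
  have hs := aeval_X_mem_supported i s
  rcases exists_eq_aeval_or_iterate_X_ne_zero hij hc hs hFi hFj with ⟨Q, hQ⟩ | h
  swap
  · exact Or.inl h
  have apply_apply : F (F (X i)) =
      Polynomial.aeval (F (X i)) (Polynomial.C c * Q + s) := by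
    rw [map_add, map_mul, Polynomial.aeval_C, ← hQ]
    conv_lhs => rw [hFi, map_add, map_mul, ← Polynomial.aeval_algHom_apply, ← algebraMap_eq,
      AlgHom.commutes]
  rcases eq_or_ne (Polynomial.C c * Q + s).natDegree 0 with hdeg | hdeg
  · rw [Polynomial.eq_C_of_natDegree_eq_zero hdeg, Polynomial.aeval_C] at apply_apply
    exact Or.inr ⟨_, apply_apply⟩
  · have transcendental_apply : Transcendental k (F (X i)) := hFi ▸
      transcendental_of_notMem_supported (C_mul_X_add_notMem_supported hc
        (supported_mono (by simpa using hij.symm) hs))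
    refine Or.inl fun m => ?_
    cases m with
    | zero => exact X_ne_zero i
    | succ m => exact iterate_ne_zero_of_transcendental transcendental_apply hdeg apply_apply m

end AffEnd

theorem exists_max_one_sup_eq_mul {ι : Type*} (s : Finset ι) (u v : ι → ℕ) {d : ℕ} (hd : d ≠ 0)
    (h : ∀ x ∈ s, u x + v x * d ≤ d * d) :
    ∃ w : ℝ≥0, w ≤ d * d ∧ max 1 (s.sup fun x => u x * d + v x * w) = d * w := by
  have one_le_d : (1 : ℝ≥0) ≤ d := mod_cast Nat.one_le_iff_ne_zero.2 hd
  have sup_le : (s.sup fun x => (u x : ℝ≥0) * d + v x * (d * d)) ≤ d * (d * d) :=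
    Finset.sup_le fun x hx => mod_cast
      calc u x * d + v x * (d * d) = d * (u x + v x * d) := by ring
        _ ≤ d * (d * d) := Nat.mul_le_mul_left d (h x hx)
  have continuous_max_sup :
      Continuous fun w : ℝ≥0 => max 1 (s.sup fun x => (u x : ℝ≥0) * d + v x * w) :=
    continuous_const.max (Continuous.finset_sup_apply fun _ _ => by fun_prop)
  obtain ⟨w, hw, hroot⟩ := isPreconnected_Icc.intermediate_value₂
    (Set.left_mem_Icc.2 zero_le) (Set.right_mem_Icc.2 (zero_le (a := (d * d : ℝ≥0))))
    (continuous_const.mul continuous_id).continuousOn continuous_max_sup.continuousOn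
    (by simp) (max_le (one_le_mul one_le_d (one_le_mul one_le_d one_le_d)) sup_le)
  exact ⟨w, hw.2, hroot.symm⟩

theorem max_one_mul_eq {θ x : ℝ≥0} (h1 : 1 ≤ θ) (h : max 1 x = θ ^ 2) :
    max 1 (θ * x) = θ * θ ^ 2 := by
  rcases max_choice 1 x with hx | hx
  · obtain rfl : θ = 1 := by simpa [hx] using h.symm
    simpa using h
  · rw [← hx.symm.trans h, max_eq_right (one_le_mul h1 (hx ▸ le_max_left _ _))]

theorem add_mul_le_mul_self_of_lt {θ : ℝ≥0} {i j d : ℕ} (hθ : 0 < θ) (hd : θ < d)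
    (h : j * θ + i ≤ θ ^ 2) : i + j * d ≤ d * d := by
  have j_le : (j : ℝ≥0) ≤ θ :=
    le_of_mul_le_mul_right ((le_self_add.trans h).trans (sq θ).le) hθ
  obtain ⟨δ, hδ⟩ := exists_add_of_le hd.le
  have add_mul_le := calc (i : ℝ≥0) + j * d
    _ = (j * θ + i) + j * δ := by rw [hδ]; ring
    _ ≤ θ ^ 2 + θ * δ := by gcongr
    _ = θ * d := by rw [hδ]; ring
    _ ≤ d * d := by gcongr
  exact_mod_cast add_mul_le

theorem coeff_single_C_mul_X_add_pow {σ R : Type*} [CommRing R] {i j : σ} (hij : i ≠ j) (c γ : R)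
    {d : ℕ} (hd : d ≠ 0) (r : ℕ) :
    coeff (Finsupp.single i (r * d)) ((C c * X j + C γ * X i ^ d) ^ r) = γ ^ r := by
  classical
  have isLeadingForm_X_pow : IsLeadingForm (Pi.single i 1) d (C c * X j + C γ * X i ^ d)
      (C γ * X i ^ d) := by
    refine ⟨by simpa using ((isWeightedHomogeneous_X R (Pi.single i (1 : ℝ≥0)) i).pow d).C_mul γ,
      ?_⟩
    rw [add_sub_cancel_right]
    refine C_mul_mem c (mem_weightLT.2 fun m hm =>
      (_root_.mem_weightLE.1 (X_mem_weightLE j) m hm).trans_lt ?_)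
    rw [Pi.single_eq_of_ne hij.symm]
    exact mod_cast hd.bot_lt
  rw [(isLeadingForm_X_pow.pow r).coeff_eq
    (by rw [Finsupp.weight_single, Pi.single_eq_same]; simp), mul_pow, ← C_pow,
    ← pow_mul, mul_comm d, coeff_C_mul, coeff_X_pow, if_pos rfl, mul_one]

section Field

variable {σ R : Type*} [Field R]

theorem C_mul_ne_C_of_isWeightedHomogeneous {μ : σ → ℝ≥0} {w : ℝ≥0} {P : MvPolynomial σ R}
    (hP : IsWeightedHomogeneous μ P w) (h0 : P ≠ 0) (hw : w ≠ 0) {c : R} (hc : c ≠ 0) (κ : R) :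
    C c * P ≠ C κ := fun h =>
  hw <| IsWeightedHomogeneous.inj_right (h ▸ mul_ne_zero (C_ne_zero.2 hc) h0)
    (h ▸ hP.C_mul c) (isWeightedHomogeneous_C μ κ)

theorem single_mem_support_of_eq_C {i j : σ} (hij : i ≠ j) {c γ κ : R} (hγ : γ ≠ 0) {d : ℕ}
    (hd : d ≠ 0) {P : MvPolynomial σ R}
    (h : C c * P + C γ * (C c * X j + C γ * X i ^ d) ^ d = C κ) :
    Finsupp.single i (d * d) ∈ P.support := by
  classical
  refine mem_support_iff.2 fun hP => ?_
  have coeff_eq := congrArg (coeff (Finsupp.single i (d * d))) h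
  rw [coeff_add, coeff_C_mul, hP, coeff_C_mul, coeff_single_C_mul_X_add_pow hij c γ hd, mul_zero,
    zero_add, coeff_C, if_neg (Finsupp.single_ne_zero.2 (mul_ne_zero hd hd)).symm] at coeff_eq
  exact mul_ne_zero hγ (pow_ne_zero d hγ) coeff_eq

end Field

namespace AffEnd

variable {k : Type*} [Field k] {a b c e : k} {p : Polynomial k} {q : MvPolynomial (Fin 3) k}
  {μ : Fin 3 → ℝ≥0} {θ : ℝ≥0}

theorem degree_vec_le_iff {P Q R : MvPolynomial (Fin 3) k} {d : ℕ} :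
    (ofFun ![P, Q, R]).degree ≤ d ↔ weightedTotalDegree (1 : Fin 3 → ℝ≥0) P ≤ d ∧
      weightedTotalDegree (1 : Fin 3 → ℝ≥0) Q ≤ d ∧
      weightedTotalDegree (1 : Fin 3 → ℝ≥0) R ≤ d := by
  simp [degree_le_iff, ← mem_weightLE_one_iff, mem_weightLE_iff_weightedTotalDegree_le,
    Fin.forall_fin_succ]

theorem isTriangular_vec (hq : q ∈ supported k {0, 1}) :
    (ofFun ![triFst a b, triSnd c p, triThd e q]).IsTriangular :=
  forall_fin_three.2 ⟨supported_mono (by simp) (triFst_mem_supported a b),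
    supported_mono (by simp [Set.insert_subset_iff]) (triSnd_mem_supported c p),
    add_mem (C_mul_mem_supported _ (X_mem_supported.2 (Set.mem_Iic.2 le_rfl)))
      (supported_mono (fun i _ => Fin.le_last i) hq)⟩

theorem IsTriangular.isPermTriangular {n : ℕ} {t f : AffEnd k n} (ht : t.IsTriangular)
    (s : Equiv.Perm (Fin n)) (hf : ∀ i, f i = t (s i)) : f.IsPermTriangular :=
  ⟨ofFun fun i => X (s i), t, ⟨s, fun _ => rfl⟩, ht, funext fun i => by
    rw [mul_apply, ofFun_apply, subst_X, hf]⟩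

theorem exists_aeval_triFst_eq (ha : a ≠ 0) (b : k) (p : Polynomial k) :
    ∃ P : Polynomial k, P.natDegree ≤ p.natDegree ∧
      Polynomial.aeval (triFst a b) P = Polynomial.aeval (X 0) p := by
  set l : Polynomial k := Polynomial.C a⁻¹ * (Polynomial.X - Polynomial.C b) with hl
  have aeval_l : Polynomial.aeval (triFst a b) l = X 0 := by
    rw [hl, map_mul, map_sub, Polynomial.aeval_C, Polynomial.aeval_X, Polynomial.aeval_C,
      algebraMap_eq, triFst, add_sub_cancel_right, ← mul_assoc, ← C_mul, inv_mul_cancel₀ ha, C_1,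
      one_mul]
  have natDegree_l : l.natDegree ≤ 1 := by
    rw [hl]
    compute_degree
  refine ⟨p.comp l, ?_, by rw [Polynomial.aeval_comp, aeval_l]⟩
  calc (p.comp l).natDegree ≤ p.natDegree * l.natDegree := Polynomial.natDegree_comp_le
    _ ≤ p.natDegree * 1 := Nat.mul_le_mul_left _ natDegree_l
    _ = p.natDegree := mul_one _

theorem isConj_cycle201 (hq : q ∈ supported k {0, 1}) {P : Polynomial k}
    (hP : Polynomial.aeval (triFst a b) P = Polynomial.aeval (X 0) p) :
    IsConj (ofFun ![triThd e q, triFst a b, triSnd c p])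
      (ofFun ![triThd e (q + C e * Polynomial.aeval (X 1) P), triFst a b, triSnd c 0]) := by
  have aeval_mem : -Polynomial.aeval (X 1 : MvPolynomial (Fin 3) k) P ∈ supported k {2}ᶜ :=
    neg_mem (supported_mono (by simp) (aeval_X_mem_supported 1 P))
  set φ : AffEnd k 3 := elementary 2 1 (-Polynomial.aeval (X 1) P) with hφ
  have φ_zero : φ 0 = X 0 := elementary_of_ne (by simp) _ _
  have φ_one : φ 1 = X 1 := elementary_of_ne (by simp) _ _
  have φ_two : φ 2 = X 2 - Polynomial.aeval (X 1) P := by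
    rw [hφ, elementary_self, C_1, one_mul, sub_eq_add_neg]
  have subst_q : φ.subst q = q :=
    subst_elementary_of_mem_supported _ _ (mem_supported_compl_two hq)
  refine isConj_of_isUnit (φ := φ) (isUnit_elementary 2 one_ne_zero aeval_mem)
    (funext (forall_fin_three.2 ⟨?_, ?_, ?_⟩)) <;> rw [mul_apply, mul_apply]
  · simp only [φ_zero, φ_one, φ_two, subst_X, ofFun_apply, triThd, Matrix.cons_val_zero, map_add,
      map_mul, subst_C, subst_q, ← Polynomial.aeval_algHom_apply]
    ring
  · simp [φ_zero, φ_one, triFst]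
  · simp [φ_one, φ_two, triSnd, ← Polynomial.aeval_algHom_apply, hP]

theorem degree_cycle201_le (ha : a ≠ 0) (hc : c ≠ 0) (he : e ≠ 0) (hq : q ∈ supported k {0, 1})
    {P : Polynomial k} (hP : P.natDegree ≤ p.natDegree) :
    (ofFun ![triThd e (q + C e * Polynomial.aeval (X 1) P), triFst a b, triSnd c 0]).degree ≤
      (ofFun ![triThd e q, triFst a b, triSnd c p]).degree := by
  have hq' : q + C e * Polynomial.aeval (X 1) P ∈ supported k {0, 1} :=
    add_mem hq (C_mul_mem_supported _ (supported_mono (by simp) (aeval_X_mem_supported 1 P)))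
  obtain ⟨h₀, -, h₂⟩ := degree_vec_le_iff.1
    (le_refl (ofFun ![triThd e q, triFst a b, triSnd c p]).degree)
  rw [weightedTotalDegree_triThd he hq, max_le_iff] at h₀
  rw [weightedTotalDegree_triSnd hc, max_le_iff] at h₂
  rw [degree_vec_le_iff, weightedTotalDegree_triThd he hq', weightedTotalDegree_triFst ha,
    weightedTotalDegree_triSnd hc]
  have aeval_le := calc
      weightedTotalDegree 1 (Polynomial.aeval (X 1 : MvPolynomial (Fin 3) k) P)
    _ = (P.natDegree : ℝ≥0) := by rw [weightedTotalDegree_aeval_X, Pi.one_apply, mul_one]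
    _ ≤ p.natDegree := mod_cast hP
    _ ≤ (ofFun ![triThd e q, triFst a b, triSnd c p]).degree := by simpa using h₂.2
  refine ⟨max_le h₀.1 (mem_weightLE_iff_weightedTotalDegree_le.1 (add_mem
    (mem_weightLE_iff_weightedTotalDegree_le.2 h₀.2)
    (C_mul_mem _ (mem_weightLE_iff_weightedTotalDegree_le.2 aeval_le)))), h₀.1, ?_⟩
  simpa using h₂.1

theorem hasStableModel_cycle201 (ha : a ≠ 0) (hc : c ≠ 0) (he : e ≠ 0)
    (hq : q ∈ supported k {0, 1}) (hu : IsUnit (ofFun ![triThd e q, triFst a b, triSnd c p])) :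
    HasStableModel (ofFun ![triThd e q, triFst a b, triSnd c p]) := by
  obtain ⟨P, hPp, hP⟩ := exists_aeval_triFst_eq ha b p
  have hq' : q + C e * Polynomial.aeval (X 1) P ∈ supported k {0, 1} :=
    add_mem hq (C_mul_mem_supported _ (supported_mono (by simp) (aeval_X_mem_supported 1 P)))
  have hconj := isConj_cycle201 (c := c) (e := e) hq hP
  refine ⟨_, ?_, hconj, degree_cycle201_le ha hc he hq hPp,
    exists_hasStableEigenvalue_cycle201 ha hc he hq' (isUnit_of_isConj hconj hu)⟩
  exact (isTriangular_vec (a := a) (b := b) (c := c) (p := 0) (e := e) hq').isPermTriangular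
    ⟨![2, 0, 1], ![1, 2, 0], by decide, by decide⟩ (forall_fin_three.2 ⟨rfl, rfl, rfl⟩)

theorem exists_isEigenvector_cycle120 (ha : a ≠ 0) (hc : c ≠ 0) (he : e ≠ 0)
    (hq : q ∈ supported k {0, 1}) (hu : IsUnit (ofFun ![triSnd c p, triThd e q, triFst a b])) :
    ∃ θ : ℝ≥0, 1 ≤ θ ∧ (∃ i j : ℕ, θ ^ 2 = i * θ + j) ∧ ∃ μ : Fin 3 → ℝ≥0, (∀ i, μ i ≠ 0) ∧
      (ofFun ![triSnd c p, triThd e q, triFst a b]).IsEigenvector θ μ := by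
  obtain ⟨θ, h1, hθ⟩ := exists_max_one_sup_eq_sq q.support (fun m => m 1) fun m => m 0
  have hθ0 : θ ≠ 0 := (zero_lt_one.trans_le h1).ne'
  have sup_le : ∀ m ∈ q.support, (m 1 : ℝ≥0) * θ + m 0 ≤ θ ^ 2 :=
    Finset.sup_le_iff.1 (hθ ▸ le_max_right _ _)
  rcases le_or_gt (p.natDegree : ℝ≥0) θ with hd | hd
  · refine ⟨θ, h1, exists_nat_mul_add_of_max_one_sup_eq hθ, ![θ, θ ^ 2, 1],
      forall_fin_three.2 ⟨hθ0, pow_ne_zero 2 hθ0, one_ne_zero⟩,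
      (isEigenvector_vec_iff hu).2 ⟨?_, ?_, ?_⟩⟩
    · rw [weightedTotalDegree_triSnd hc]
      simpa [sq] using mul_le_mul_left hd θ
    · rw [weightedTotalDegree_triThd he hq, weightedTotalDegree_eq_sup hq]
      refine (congrArg (max 1) ?_).trans (max_one_mul_eq h1 hθ)
      rw [NNReal.mul_finset_sup]
      exact Finset.sup_congr rfl fun m _ => by simp; ring
    · simp [weightedTotalDegree_triFst ha]
  · have one_lt_d : (1 : ℝ≥0) < p.natDegree := h1.trans_lt hd
    have hd0 : p.natDegree ≠ 0 := fun h => by simp [h] at hd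
    have le_sq : ∀ m ∈ q.support, m 0 + m 1 * p.natDegree ≤ p.natDegree * p.natDegree :=
      fun m hm => add_mul_le_mul_self_of_lt (pos_of_ne_zero hθ0) hd (sup_le m hm)
    obtain ⟨w, hwd, hw⟩ :=
      exists_max_one_sup_eq_mul q.support (fun m => m 0) (fun m => m 1) hd0 le_sq
    have hw0 : w ≠ 0 := by
      rintro rfl
      rw [mul_zero] at hw
      exact (zero_lt_one.trans_le (le_max_left _ _)).ne' hw
    refine ⟨p.natDegree, one_lt_d.le, ⟨p.natDegree, 0, by simp [sq]⟩, ![p.natDegree, w, 1],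
      forall_fin_three.2 ⟨Nat.cast_ne_zero.2 hd0, hw0, one_ne_zero⟩,
      (isEigenvector_vec_iff hu).2 ⟨?_, ?_, ?_⟩⟩
    · simpa [weightedTotalDegree_triSnd hc] using hwd
    · simpa [weightedTotalDegree_triThd he hq, weightedTotalDegree_eq_sup hq] using hw
    · simp [weightedTotalDegree_triFst ha]

theorem exists_weightedHomogeneousComponent_triSnd {w : ℝ≥0} (h0 : 0 < μ 0) (h1 : μ 1 = w)
    (hle : p.natDegree * μ 0 ≤ w) :
    ∃ s : Polynomial k,
      weightedHomogeneousComponent μ w (triSnd c p) = C c * X 1 + Polynomial.aeval (X 0) s ∧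
        (s = 0 ∨ p.natDegree * μ 0 = w ∧
          s = Polynomial.C p.leadingCoeff * Polynomial.X ^ p.natDegree) := by
  rcases hle.eq_or_lt with hw | hw
  · refine ⟨_, ?_, Or.inr ⟨hw, rfl⟩⟩
    rw [weightedHomogeneousComponent_triSnd h0 hw, if_pos h1]
    simp
  · refine ⟨0, ?_, Or.inl rfl⟩
    have component_aeval : weightedHomogeneousComponent μ w
        (Polynomial.aeval (X 0 : MvPolynomial (Fin 3) k) p) = 0 :=
      weightedHomogeneousComponent_eq_zero w _ ((weightedTotalDegree_aeval_X 0 p).trans_lt hw)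
    rw [triSnd, map_add, weightedHomogeneousComponent_C_mul_X, if_pos h1, component_aeval, map_zero]

theorem add_mul_le_of_weightedTotalDegree_le (hq : q ∈ supported k {0, 1}) (h0 : 0 < μ 0) {d : ℕ}
    (h1 : μ 1 = d * μ 0) (h : weightedTotalDegree μ q ≤ d * μ 1) :
    ∀ m ∈ q.support, m 0 + m 1 * d ≤ d * d := fun m hm => by
  rw [weightedTotalDegree_eq_sup hq] at h
  have weight_le := calc ((m 0 + m 1 * d : ℕ) : ℝ≥0) * μ 0
    _ = m 0 * μ 0 + m 1 * μ 1 := by rw [h1]; push_cast; ring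
    _ ≤ d * μ 1 := Finset.sup_le_iff.1 h m hm
    _ = (d * d : ℕ) * μ 0 := by rw [h1]; push_cast; ring
  exact_mod_cast le_of_mul_le_mul_right weight_le h0

theorem leadingNonvanishing_or_eq_C (hc : c ≠ 0) (hq : q ∈ supported k {0, 1}) {f : AffEnd k 3}
    (hf0 : f 0 = triSnd c p) (hf1 : f 1 = triThd e q) (h0 : 0 < μ 0) (h1 : μ 1 = θ * μ 0)
    (h2 : μ 2 ≠ θ * μ 1) (hle : p.natDegree * μ 0 ≤ θ * μ 0) :
    LeadingNonvanishing μ θ f ∨ ∃ (κ : k) (s : Polynomial k),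
      C c * weightedHomogeneousComponent μ (θ * μ 1) q +
          Polynomial.aeval (C c * X 1 + Polynomial.aeval (X 0) s) s = C κ ∧
        (s = 0 ∨ p.natDegree * μ 0 = θ * μ 0 ∧
          s = Polynomial.C p.leadingCoeff * Polynomial.X ^ p.natDegree) := by
  obtain ⟨s, component_eq, hs⟩ := exists_weightedHomogeneousComponent_triSnd (c := c) h0 h1 hle
  set F := (leadingPart μ θ f).subst with hF
  have F_X_zero : F (X 0) = C c * X 1 + Polynomial.aeval (X 0) s := by
    rw [hF, subst_leadingPart_X, hf0, component_eq]
  have F_X_one : F (X 1) = weightedHomogeneousComponent μ (θ * μ 1) q := by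
    rw [hF, subst_leadingPart_X, hf1, weightedHomogeneousComponent_triThd h2]
  rcases iterate_X_ne_zero_or_exists_eq_C zero_ne_one hc F_X_zero
    (F_X_one ▸ weightedHomogeneousComponent_mem_supported hq) with h | ⟨κ, hκ⟩
  · exact Or.inl (leadingNonvanishing_of_iterate h0 h)
  refine Or.inr ⟨κ, s, ?_, hs⟩
  rwa [F_X_zero, map_add, map_mul, F_X_one, ← Polynomial.aeval_algHom_apply, F_X_zero,
    ← algebraMap_eq, AlgHom.commutes, algebraMap_eq] at hκ

theorem ne_mul_of_eq_mul_of_one_lt {x y z : ℝ≥0} (h1 : 1 < θ) (hx : 0 < x) (hy : y = θ * x)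
    (hz : x = θ * z) : z ≠ θ * y := by
  have lt_mul {t : ℝ≥0} (ht : 0 < t) : t < θ * t := lt_mul_of_one_lt_left ht h1
  have hz0 : 0 < z := pos_of_ne_zero fun h => hx.ne' (by rw [hz, h, mul_zero])
  refine ne_of_lt ?_
  calc z < θ * z := lt_mul hz0
    _ = x := hz.symm
    _ < θ * x := lt_mul hx
    _ = y := hy.symm
    _ < θ * y := lt_mul (hx.trans (hy ▸ lt_mul hx))

theorem leadingNonvanishing_or_support (ha : a ≠ 0) (hc : c ≠ 0) (he : e ≠ 0)
    (hq : q ∈ supported k {0, 1}) (hu : IsUnit (ofFun ![triSnd c p, triThd e q, triFst a b]))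
    (h1 : 1 < θ) (hμ : μ ≠ 0)
    (hE : (ofFun ![triSnd c p, triThd e q, triFst a b]).IsEigenvector θ μ) :
    LeadingNonvanishing μ θ (ofFun ![triSnd c p, triThd e q, triFst a b]) ∨
      p.natDegree ≠ 0 ∧ Finsupp.single 0 (p.natDegree * p.natDegree) ∈ q.support ∧
        ∀ m ∈ q.support, m 0 + m 1 * p.natDegree ≤ p.natDegree * p.natDegree := by
  obtain ⟨h₀, h₁, h₂⟩ := (isEigenvector_vec_iff hu).1 hE
  rw [weightedTotalDegree_triSnd hc] at h₀
  rw [weightedTotalDegree_triFst ha] at h₂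
  have hθ : 0 < θ := zero_lt_one.trans h1
  have hμ0 : 0 < μ 0 := by
    refine pos_of_ne_zero fun h0 => hμ (funext (forall_fin_three.2 ⟨h0, ?_, ?_⟩))
    · simpa [h0] using h₀
    · simpa [h0, hθ.ne'] using h₂
  by_cases hμ1 : μ 1 = θ * μ 0
  swap
  · exact Or.inl (leadingNonvanishing_of_apply_zero rfl hθ hμ0 h₀ hμ1)
  have hμ2 : μ 2 ≠ θ * μ 1 := ne_mul_of_eq_mul_of_one_lt h1 hμ0 hμ1 h₂
  have hq₁ : weightedTotalDegree μ q = θ * μ 1 := weightedTotalDegree_eq_of_triThd he hq h₁ hμ2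
  rcases leadingNonvanishing_or_eq_C hc hq
      (f := ofFun ![triSnd c p, triThd e q, triFst a b]) rfl rfl hμ0 hμ1 hμ2
      (h₀ ▸ le_max_right _ _) with h | ⟨κ, s, hκ, rfl | ⟨hd, rfl⟩⟩
  · exact Or.inl h
  · have hw : θ * μ 1 ≠ 0 := (mul_pos hθ (hμ1 ▸ mul_pos hθ hμ0)).ne'
    refine absurd ?_ (C_mul_ne_C_of_isWeightedHomogeneous
      (weightedHomogeneousComponent_isWeightedHomogeneous _ _)
      (weightedHomogeneousComponent_ne_zero hq₁ hw) hw hc κ)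
    simpa using hκ
  · obtain rfl : (p.natDegree : ℝ≥0) = θ := mul_right_cancel₀ hμ0.ne' hd
    have hd0 : p.natDegree ≠ 0 := Nat.cast_ne_zero.1 hθ.ne'
    have hp : p.leadingCoeff ≠ 0 :=
      Polynomial.leadingCoeff_ne_zero.2 fun h => hd0 (by rw [h, Polynomial.natDegree_zero])
    refine Or.inr ⟨hd0, ?_, add_mul_le_of_weightedTotalDegree_le hq hμ0 hμ1 hq₁.le⟩
    have single_mem := single_mem_support_of_eq_C zero_ne_one hp hd0 (by simpa using hκ)
    rw [mem_support_iff, coeff_weightedHomogeneousComponent] at single_mem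
    exact mem_support_iff.2 (ite_ne_right_iff.1 single_mem).2

end AffEnd

namespace AffEnd

variable {k : Type*} [Field k] {a b c e : k} {p₁ s : Polynomial k}
  {q : MvPolynomial (Fin 3) k} {d : ℕ}

/-- The polynomial taking the place of `q` when the map with components `triSnd c (p₁ + s)`,
`triThd e q`, `triFst a b` is conjugated by the shear `X₁ ↦ c X₁ + s(X₀)`. -/
def shearThd (c : k) (p₁ s : Polynomial k) (q : MvPolynomial (Fin 3) k) : MvPolynomial (Fin 3) k :=
  C c * (elementary 1 c⁻¹ (-(C c⁻¹ * Polynomial.aeval (X 0) s))).subst q +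
    Polynomial.aeval (triSnd 1 p₁) s

theorem shearThd_mem_supported (hq : q ∈ supported k {0, 1}) :
    shearThd c p₁ s q ∈ supported k {0, 1} := by
  refine add_mem (C_mul_mem_supported c (subst_mem_supported ?_ hq))
    (aeval_mem_supported (triSnd_mem_supported 1 p₁) s)
  have shear_mem : C c⁻¹ * X 1 + -(C c⁻¹ * Polynomial.aeval (X 0) s) ∈
      supported k ({0, 1} : Set (Fin 3)) :=
    add_mem (C_mul_mem_supported _ (X_mem_supported.2 (by simp)))
      (neg_mem (C_mul_mem_supported _ (supported_mono (by simp) (aeval_X_mem_supported 0 s))))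
  rintro i (rfl | rfl)
  · rw [elementary_of_ne zero_ne_one]
    exact X_mem_supported.2 (by simp)
  · rwa [elementary_self]

theorem shearThd_mem_weightLE (hp₁ : p₁.natDegree ≤ d) (hs : s.natDegree ≤ d)
    (hq : q ∈ weightLE k ![1, d, 1] (d * d)) :
    shearThd c p₁ s q ∈ weightLE k ![1, d, 1] (d * d) := by
  set ν : Fin 3 → ℝ≥0 := ![1, d, 1] with hν
  have aeval_X_mem {r : Polynomial k} (hr : r.natDegree ≤ d) :
      Polynomial.aeval (X 0 : MvPolynomial (Fin 3) k) r ∈ weightLE k ν d :=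
    weightLE_mono (by simpa [hν] using hr) (aeval_mem_weightLE (X_mem_weightLE 0) r)
  have triSnd_mem : triSnd 1 p₁ ∈ weightLE k ν d :=
    add_mem (C_mul_mem _ (X_mem_weightLE 1)) (aeval_X_mem hp₁)
  have shear_mem : ∀ i, elementary 1 c⁻¹ (-(C c⁻¹ * Polynomial.aeval (X 0) s)) i ∈
      weightLE k ν (1 * ν i) := by
    simp only [one_mul]
    refine forall_fin_three.2 ⟨?_, ?_, ?_⟩
    · rw [elementary_of_ne zero_ne_one]
      exact X_mem_weightLE 0
    · rw [elementary_self]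
      exact add_mem (C_mul_mem _ (X_mem_weightLE 1)) (neg_mem (C_mul_mem _ (aeval_X_mem hs)))
    · rw [elementary_of_ne (by simp)]
      exact X_mem_weightLE 2
  refine add_mem (C_mul_mem _ (one_mul (d * d : ℝ≥0) ▸ bind₁_mem_weightLE shear_mem hq))
    (weightLE_mono ?_ (aeval_mem_weightLE triSnd_mem s))
  gcongr

theorem isConj_cycle120 (hc : c ≠ 0) :
    IsConj (ofFun ![triSnd c (p₁ + s), triThd e q, triFst a b])
      (ofFun ![triSnd 1 p₁, triThd (c * e) (shearThd c p₁ s q), triFst a b]) := by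
  have hs := aeval_X_zero_mem_supported_compl_one s
  set φ : AffEnd k 3 := elementary 1 c (Polynomial.aeval (X 0) s) with hφ
  have φ_zero : φ 0 = X 0 := elementary_of_ne (by simp) _ _
  have φ_one : φ 1 = C c * X 1 + Polynomial.aeval (X 0) s := elementary_self _ _ _
  have φ_two : φ 2 = X 2 := elementary_of_ne (by simp) _ _
  have subst_triSnd : φ.subst (triSnd 1 p₁) = triSnd c (p₁ + s) := by
    simp only [triSnd, C_1, one_mul, map_add, subst_X, φ_one, ← Polynomial.aeval_algHom_apply,
      φ_zero]
    ring
  have subst_shearThd : φ.subst (shearThd c p₁ s q) =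
      C c * q + Polynomial.aeval (triSnd c (p₁ + s)) s := by
    rw [shearThd, map_add, map_mul, subst_C, ← subst_mul, hφ,
      elementary_mul_elementary' (mul_inv_cancel₀ hc) hs, subst_one, ← hφ,
      ← Polynomial.aeval_algHom_apply, subst_triSnd]
  refine isConj_of_isUnit (φ := φ) (isUnit_elementary 1 hc hs)
    (funext (forall_fin_three.2 ⟨?_, ?_, ?_⟩)) <;> rw [mul_apply, mul_apply]
  · rw [φ_zero, subst_X]
    exact subst_triSnd.symm
  · simp only [φ_one, φ_two, ofFun_apply, Matrix.cons_val_one, Matrix.cons_val_zero, map_add,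
      map_mul, subst_C, subst_X, ← Polynomial.aeval_algHom_apply, triThd, subst_shearThd]
    ring
  · simp [φ_zero, φ_two, triFst]

theorem degree_cycle120_le (hc : c ≠ 0) (he : e ≠ 0) (hq : q ∈ supported k {0, 1})
    {p : Polynomial k} (hp₁ : p₁.natDegree ≤ p.natDegree) (hs : s.natDegree ≤ p.natDegree)
    (hd : p.natDegree ≠ 0)
    (hqd : Finsupp.single 0 (p.natDegree * p.natDegree) ∈ q.support)
    (hqle : ∀ m ∈ q.support, m 0 + m 1 * p.natDegree ≤ p.natDegree * p.natDegree) :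
    (ofFun ![triSnd 1 p₁, triThd (c * e) (shearThd c p₁ s q), triFst a b]).degree ≤
      (ofFun ![triSnd c p, triThd e q, triFst a b]).degree := by
  obtain ⟨h₀, h₁, h₂⟩ := degree_vec_le_iff.1
    (le_refl (ofFun ![triSnd c p, triThd e q, triFst a b]).degree)
  rw [weightedTotalDegree_triSnd hc, max_le_iff] at h₀
  rw [weightedTotalDegree_triThd he hq, max_le_iff] at h₁
  rw [degree_vec_le_iff, weightedTotalDegree_triSnd one_ne_zero,
    weightedTotalDegree_triThd (mul_ne_zero hc he) (shearThd_mem_supported hq)]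
  refine ⟨max_le h₀.1 (le_trans (by gcongr) h₀.2), max_le h₁.1 ?_, h₂⟩
  have hqν : q ∈ weightLE k ![1, p.natDegree, 1] (p.natDegree * p.natDegree) := by
    rw [mem_weightLE_iff_weightedTotalDegree_le, weightedTotalDegree_eq_sup hq]
    exact Finset.sup_le fun m hm => by simpa using mod_cast hqle m hm
  have one_le : (1 : Fin 3 → ℝ≥0) ≤ ![1, (p.natDegree : ℝ≥0), 1] :=
    Pi.le_def.2 <| forall_fin_three.2
      ⟨le_rfl, Nat.one_le_cast.2 (Nat.one_le_iff_ne_zero.2 hd), le_rfl⟩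
  have sq_le : (p.natDegree * p.natDegree : ℝ≥0) ≤
      (ofFun ![triSnd c p, triThd e q, triFst a b]).degree := by
    refine le_trans ?_ ((le_weightedTotalDegree 1 hqd).trans h₁.2)
    simp only [Finsupp.weight_single, Pi.one_apply, nsmul_eq_mul, Nat.cast_mul, mul_one, le_refl]
  exact mem_weightLE_iff_weightedTotalDegree_le.1 <| weightLE_mono sq_le <| mem_weightLE.2
    fun m hm => (weight_mono one_le m).trans
      (mem_weightLE.1 (shearThd_mem_weightLE hp₁ hs hqν) m hm)

end AffEnd

namespace AffEnd

variable {k : Type*} [Field k] {a b c e : k} {p : Polynomial k} {q : MvPolynomial (Fin 3) k}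

/-- If the leading part degenerates, conjugating by `X₁ ↦ c X₁ + γ X₀ ^ d`, where `γ X₀ ^ d` is the
leading term of `p`, lowers the degree of `p`. -/
theorem hasStableModel_cycle120 (ha : a ≠ 0) (hc : c ≠ 0) (he : e ≠ 0)
    (hq : q ∈ supported k {0, 1}) (hu : IsUnit (ofFun ![triSnd c p, triThd e q, triFst a b])) :
    HasStableModel (ofFun ![triSnd c p, triThd e q, triFst a b]) := by
  induction hN : p.natDegree using Nat.strong_induction_on generalizing c e p q with
  | _ N ih =>
    subst hN
    obtain ⟨θ, h1, hH, μ, hμ, hE⟩ := exists_isEigenvector_cycle120 ha hc he hq hu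
    by_cases hS : 1 < θ → ∀ μ : Fin 3 → ℝ≥0, μ ≠ 0 →
        (ofFun ![triSnd c p, triThd e q, triFst a b]).IsEigenvector θ μ →
        LeadingNonvanishing μ θ (ofFun ![triSnd c p, triThd e q, triFst a b])
    · refine ⟨_, ?_, IsConj.refl _, le_rfl, θ, hasStableEigenvalue_of_isEigenvector hu h1 hH
        (fun h => hμ 0 (congrFun h 0)) hE 0 (fun i hi => absurd hi (hμ i)) hS⟩
      exact (isTriangular_vec (a := a) (b := b) (c := c) (p := p) (e := e) hq).isPermTriangular
        ⟨![1, 2, 0], ![2, 0, 1], by decide, by decide⟩ (forall_fin_three.2 ⟨rfl, rfl, rfl⟩)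
    · push Not at hS
      obtain ⟨hθ, μ, hμ0, hE, hnot⟩ := hS
      obtain ⟨hd, hqd, hqle⟩ :=
        (leadingNonvanishing_or_support ha hc he hq hu hθ hμ0 hE).resolve_left hnot
      set s := Polynomial.C p.leadingCoeff * Polynomial.X ^ p.natDegree
      have hps : p.eraseLead + s = p := p.eraseLead_add_C_mul_X_pow
      have hp₁ := p.eraseLead_natDegree_le
      have hconj := isConj_cycle120 (a := a) (b := b) (e := e) (q := q)
        (p₁ := p.eraseLead) (s := s) hc
      rw [hps] at hconj
      refine (ih p.eraseLead.natDegree (by omega) one_ne_zero (mul_ne_zero hc he)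
        (shearThd_mem_supported hq) (isUnit_of_isConj hconj hu) rfl).of_isConj hconj ?_
      exact degree_cycle120_le hc he hq (by omega) (Polynomial.natDegree_C_mul_X_pow_le _ _) hd
        hqd hqle

theorem perm_fin_three_eq (s : Equiv.Perm (Fin 3)) :
    (s : Fin 3 → Fin 3) ∈
      [![0, 1, 2], ![1, 0, 2], ![0, 2, 1], ![2, 1, 0], ![2, 0, 1], ![1, 2, 0]] := by
  revert s
  decide

theorem hasStableModel_of_vec (ha : a ≠ 0) (hc : c ≠ 0) (he : e ≠ 0)
    (hq : q ∈ supported k {0, 1}) (s : Equiv.Perm (Fin 3))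
    (hu : IsUnit (ofFun fun i => ![triFst a b, triSnd c p, triThd e q] (s i))) :
    HasStableModel (ofFun fun i => ![triFst a b, triSnd c p, triThd e q] (s i)) := by
  have hperm : (ofFun fun i => ![triFst a b, triSnd c p, triThd e q] (s i)).IsPermTriangular :=
    (isTriangular_vec hq).isPermTriangular s fun _ => rfl
  have vec_eq (t : Fin 3 → Fin 3) (hs : (s : Fin 3 → Fin 3) = t) :
      (ofFun fun i => ![triFst a b, triSnd c p, triThd e q] (s i)) =
        ofFun ![![triFst a b, triSnd c p, triThd e q] (t 0),
          ![triFst a b, triSnd c p, triThd e q] (t 1),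
          ![triFst a b, triSnd c p, triThd e q] (t 2)] := by
    subst hs
    exact funext (forall_fin_three.2 ⟨rfl, rfl, rfl⟩)
  have hs := perm_fin_three_eq s
  simp only [List.mem_cons, List.not_mem_nil, or_false] at hs
  rcases hs with hs | hs | hs | hs | hs | hs <;> rw [vec_eq _ hs] at hperm hu ⊢
  · exact ⟨_, hperm, IsConj.refl _, le_rfl, 1, hasStableEigenvalue_id ha hc he hq hu⟩
  · exact ⟨_, hperm, IsConj.refl _, le_rfl, exists_hasStableEigenvalue_swap01 ha hc he hq hu⟩
  · exact ⟨_, hperm, IsConj.refl _, le_rfl, exists_hasStableEigenvalue_swap12 ha hc he hq hu⟩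
  · exact ⟨_, hperm, IsConj.refl _, le_rfl, exists_hasStableEigenvalue_swap02 ha hc he hq hu⟩
  · exact hasStableModel_cycle201 ha hc he hq hu
  · exact hasStableModel_cycle120 ha hc he hq hu

theorem isUnit_of_isUnit_perm {n : ℕ} {t : AffEnd k n} (s : Equiv.Perm (Fin n))
    (h : IsUnit (ofFun fun i => t (s i))) : IsUnit t := by
  have perm_mul_perm (r : Equiv.Perm (Fin n)) :
      (ofFun fun i => X (r i) : AffEnd k n) * (ofFun fun i => X (r.symm i)) = 1 := by
    funext i
    rw [mul_apply, ofFun_apply, subst_X, ofFun_apply, Equiv.symm_apply_apply, one_apply]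
  have isUnit_perm : IsUnit (ofFun fun i => X (s i) : AffEnd k n) :=
    isUnit_iff_exists.2 ⟨_, perm_mul_perm s, perm_mul_perm s.symm⟩
  have perm_mul : (ofFun fun i => X (s i)) * t = ofFun fun i => t (s i) := by
    funext i
    rw [mul_apply, ofFun_apply, subst_X, ofFun_apply]
  exact isUnit_perm.mul_left_iff.1 (perm_mul ▸ h)

theorem hasStableModel_of_isAffineTriangular {f : AffEnd k 3} (hf : IsUnit f)
    (hft : f.IsAffineTriangular) : HasStableModel f := by
  obtain ⟨s, t, ht, hconj, hdeg⟩ := hft.exists_isConj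
  have hu := isUnit_of_isConj hconj hf
  obtain ⟨a, b, c, e, p, q, ha, hc, he, hq, rfl⟩ :=
    ht.exists_normal_form (isUnit_of_isUnit_perm s hu)
  exact (hasStableModel_of_vec ha hc he hq s hu).of_isConj hconj hdeg

end AffEnd

end

theorem propositionD {k : Type*} [Field k] (f : AffEnd k 3)
    (hf : f.IsAut) (hft : f.IsAffineTriangular) :
    ∃ f' : AffEnd k 3, f'.IsAut ∧ f'.IsPermTriangular ∧ IsConj f f' ∧ f'.degree ≤ f.degree ∧
      ∃ θ : NNReal, f'.IsMaximalEigenvalue θ ∧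
        (θ = 1 ∨ ∀ μ : Fin 3 → NNReal, f'.IsMaximalEigenvector μ → f'.IsMuAlgStable μ) ∧
        f.HasDynamicalDegree θ ∧ f'.HasDynamicalDegree θ ∧ IsHandelman θ := by
  obtain ⟨f', hp, hc, hd, θ, hθ⟩ := AffEnd.hasStableModel_of_isAffineTriangular hf hft
  exact ⟨f', AffEnd.isUnit_of_isConj hc hf, hp, hc, hd, θ, hθ.isMaximalEigenvalue, hθ.stable,
    (hθ.growth.of_isConj hc).hasDynamicalDegree, hθ.growth.hasDynamicalDegree, hθ.handelman⟩
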